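/- Let $f\in C([0,1])$ satisfy (H) $f(0)=f(1)=0$ and, for some $k>0$, $|f(s)|\le ks$ and $|f(s)|\le k(1-s)$ for all $s\in[0,1]$. Let $f$ be of type B (combustion type): for some $\alpha\in(0,1)$, $f=0$ on $[0,\alpha]$ and $f>0$ on $(\alpha,1)$. Assume that $f|_{[\alpha,1]}$ satisfies (F) $f|_{[\alpha,1]}$ is locally Lipschitz continuous and has a unique local maximum point, which lies in $(\alpha,1)$. For $\varepsilon>0$ call $c\in\mathbb R$ an admissible speed if the problem $$y'=c\,\frac{\sqrt{y(2\varepsilon+y)}}{\varepsilon+y}-f(v)\ \text{ on } [0,1],\qquad y(0)=y(1)=0,\quad y>0\text{ on }(0,1),$$ has a solution $y=y(v)$. Then for every $\varepsilon>0$ there is exactly one admissible speed $c^*_\varepsilon$ (the critical speed), and there is exactly one monotone solution $v_\varepsilon:\mathbb R\to\mathbb R$, with $|v_\varepsilon'|<1$, of $$\varepsilon\left(\frac{v_\varepsilon'}{\sqrt{1-(v_\varepsilon')^2}}\right)'-c^*_\varepsilon v_\varepsilon'+f(v_\varepsilon)=0,\qquad v_\varepsilon(-\infty)=0,\quad v_\varepsilon(+\infty)=1,\quad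 v_\varepsilon(0)=\alpha$$ (the critical front). Set $F(v)=\int_0^v f(s)\,ds$. The equation $F(v)=vf(v)$ has a largest solution $v_+$ in $[0,1]$, it satisfies $\alpha<v_+<1$, and, as $\varepsilon\to0^+$, $c^*_\varepsilon\to f(v_+)$ and $v_\varepsilon\to\bar v$ uniformly in $\mathbb R$, where $$\bar v(z)=\begin{cases}\mathcal V_L(z;0,\alpha), & z\le v_+-\alpha,\\ \mathcal V_I(z;v_+-\alpha,v_+), & z>v_+-\alpha.\end{cases}$$ Here $\mathcal V_L(z;z_0,v_0)$ equals $0$ for $z<z_0-v_0$, equals $z-z_0+v_0$ for $z_0-v_0\le z\le 1+z_0-v_0$, and equals $1$ for $z>1+z_0-v_0$; and $\mathcal V_I(\cdot;z_0,v_0)$ is the unique solution $v:\mathbb R\to[0,1]$ of the inviscid problem $f(v_+)\,v'=f(v)$ on $\mathbb R$, $v(z_0)=v_0$. -/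

import Mathlib

open Set Filter Topology

noncomputable section

/-- Assumption (H): `f` is continuous on `[0, 1]`, vanishes at `0` and `1`, and is linearly
controlled at both ends. Only the values of `f` on `[0, 1]` matter. -/
structure HypH (f : ℝ → ℝ) : Prop where
  continuousOn : ContinuousOn f (Icc 0 1)
  map_zero : f 0 = 0
  map_one : f 1 = 0
  linear_control : ∃ k : ℝ, 0 < k ∧ ∀ s ∈ Icc (0 : ℝ) 1, |f s| ≤ k * s ∧ |f s| ≤ k * (1 - s)

/-- `f` is of type B (combustion type) with ignition threshold `α`. -/
structure IsTypeB (f : ℝ → ℝ) (α : ℝ) : Prop where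
  threshold_mem : α ∈ Ioo (0 : ℝ) 1
  eq_zero : ∀ u ∈ Icc 0 α, f u = 0
  pos : ∀ u ∈ Ioo α 1, 0 < f u

/-- Assumption (F) for the restriction of `f` to `[p, q]`: this restriction is locally Lipschitz
and has a unique local maximum point, which is interior. -/
structure HypFOn (f : ℝ → ℝ) (p q : ℝ) : Prop where
  locallyLipschitz : LocallyLipschitzOn (Icc p q) f
  unique_localMax : ∃ vmax ∈ Ioo p q,
    ∀ x ∈ Icc p q, IsLocalMaxOn f (Icc p q) x ↔ x = vmax

/-- The primitive `F(v) = ∫₀ᵛ f(s) ds`. -/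
def reactionPrimitive (f : ℝ → ℝ) (v : ℝ) : ℝ := ∫ s in (0 : ℝ)..v, f s

/-- `y` solves the first-order reduction
`y' = c √(y (2ε + y)) / (ε + y) - f(v)`, `y(0) = y(1) = 0`, `y > 0` on `(0, 1)`. -/
structure IsFirstOrderSolution (f : ℝ → ℝ) (ε c : ℝ) (y : ℝ → ℝ) : Prop where
  ode : ∀ v ∈ Icc (0 : ℝ) 1,
    HasDerivWithinAt y (c * (√(y v * (2 * ε + y v)) / (ε + y v)) - f v) (Icc 0 1) v
  map_zero : y 0 = 0
  map_one : y 1 = 0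
  pos : ∀ v ∈ Ioo (0 : ℝ) 1, 0 < y v

/-- `c` is an admissible speed: the first-order two-point problem is solvable. -/
def IsAdmissibleSpeed (f : ℝ → ℝ) (ε c : ℝ) : Prop :=
  ∃ y : ℝ → ℝ, IsFirstOrderSolution f ε c y

/-- The critical speed `c*_ε`, i.e. the least admissible speed. -/
def criticalSpeed (f : ℝ → ℝ) (ε : ℝ) : ℝ := sInf {c : ℝ | IsAdmissibleSpeed f ε c}

/-- `v` is a monotone heteroclinic solution, joining `0` and `1`, of
`ε (v' / √(1 - (v')²))' - c v' + f(v) = 0` on the whole real line. -/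
structure IsFront (f : ℝ → ℝ) (ε c : ℝ) (v : ℝ → ℝ) : Prop where
  monotone : Monotone v
  differentiable : Differentiable ℝ v
  slope_lt_one : ∀ z, |deriv v z| < 1
  ode : ∀ z, HasDerivAt (fun s => ε * (deriv v s / √(1 - deriv v s ^ 2)))
    (c * deriv v z - f (v z)) z
  tendsto_atBot : Tendsto v atBot (𝓝 0)
  tendsto_atTop : Tendsto v atTop (𝓝 1)

/-- `v` is the critical front `v_ε`, normalized by `v(0) = V₀`. -/
def IsCriticalFront (f : ℝ → ℝ) (V₀ ε : ℝ) (v : ℝ → ℝ) : Prop :=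
  IsFront f ε (criticalSpeed f ε) v ∧ v 0 = V₀

/-- The piecewise linear profile `𝒱_L(z; z₀, v₀)`. -/
def piecewiseLinearProfile (z₀ v₀ z : ℝ) : ℝ :=
  if z < z₀ - v₀ then 0 else if z ≤ 1 + z₀ - v₀ then z - z₀ + v₀ else 1

/-- `V` is the inviscid profile `𝒱_I(·; z₀, v₀)`: it is `[0, 1]`-valued and solves
`c V' = f(V)` on the real line, `V(z₀) = v₀`. -/
structure IsInviscidProfile (f : ℝ → ℝ) (c z₀ v₀ : ℝ) (V : ℝ → ℝ) : Prop where
  mem_Icc : ∀ z, V z ∈ Icc (0 : ℝ) 1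
  differentiable : Differentiable ℝ V
  ode : ∀ z, c * deriv V z = f (V z)
  initial : V z₀ = v₀

/-- The profile equal to `L` on `(-∞, p]` and to `R` on `(p, +∞)`. -/
def gluedProfile (p : ℝ) (L R : ℝ → ℝ) (z : ℝ) : ℝ := if z ≤ p then L z else R z

end

/-! Regard `y = ε (1 / √(1 - v'²) - 1)` as a function of the level `v`. A front becomes a solution
of `y' = c g(y) - f`, where `g = frontSlope ε` recovers `v'`, increases from `0` and stays below
`1`. This `g` is not Lipschitz at `y = 0`, but its monotonicity gives comparison, hence uniqueness,
backward in `v`. On `[0, α]`, where `f = 0`, the momentum `√(y (2ε + y))` equals `c v`, so `y(α)` is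
explicit and increases with `c`. Shooting back from `y(1) = 0` and matching at `α` produces a speed
(`exists_isFirstOrderSolution`). Two speeds would give solutions whose gap cannot shrink between `α`
and `1`, although both vanish at `1` (`IsFirstOrderSolution.speed_le`). Integrating `v' = g(y(v))`
yields the front. It is unique because the system for `v` and the momentum is Lipschitz.

As `ε → 0`, `g(y) → 1` for every `y > 0`. From `g < 1` follows `0 < y ≤ c v - F(v)` on `(0, 1)`, so
`c` exceeds the slope of every chord `F(v) / v`; the steepest chord, at `vp`, gives `c > f(vp)`. If
`c ≥ f(vp) + δ`, a line of slope strictly between `f(vp)` and `c`, minus `F`, is a positive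
subsolution for small `ε`, against `y(1) = 0` (`eventually_speed_lt`).

Similar barriers keep `y` away from `0` on compact subsets of `(0, vp)`, so the slope tends to `1`
there. Near and beyond `vp`, `y` becomes small and `c g(y)` balances `f(v)`. Hence the slope tends
to `f(max vp v) / f(vp)`, uniformly away from `v = 0` (`eventually_frontSlope_sub_le`). For `z ≥ 0`
the glued profile is one solution of the equation with this Lipschitz limit field. Grönwall then
gives convergence on compact intervals, and monotonicity handles the tails. -/

/-! ### Comparison principle and Lipschitz bounds on compact sets -/

/-- Up to its first zero `d` is nondecreasing, so that zero cannot occur. All barrier arguments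
below rest on this trapping principle. -/
theorem le_of_deriv_nonneg_of_nonneg {a b : ℝ} {d d' : ℝ → ℝ} (hab : a ≤ b)
    (hd : ∀ t ∈ Icc a b, HasDerivWithinAt d (d' t) (Icc a b) t) (ha : 0 < d a)
    (h : ∀ t ∈ Icc a b, 0 ≤ d t → 0 ≤ d' t) : d a ≤ d b := by
  have hc : ContinuousOn d (Icc a b) := fun t ht => (hd t ht).continuousWithinAt
  have key : ∀ t ∈ Icc a b, (∀ s ∈ Ico a t, 0 ≤ d s) → d a ≤ d t := by
    intro t ht hs
    have hm : MonotoneOn d (Icc a t) := by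
      refine monotoneOn_of_hasDerivWithinAt_nonneg (f' := d') (convex_Icc a t)
        (hc.mono (Icc_subset_Icc_right ht.2)) ?_ ?_
      · intro x hx
        rw [interior_Icc] at hx ⊢
        exact (hd x ⟨hx.1.le, hx.2.le.trans ht.2⟩).mono
          (fun y hy => ⟨hy.1.le, hy.2.le.trans ht.2⟩)
      · intro x hx
        rw [interior_Icc] at hx
        exact h x ⟨hx.1.le, hx.2.le.trans ht.2⟩ (hs x ⟨hx.1.le, hx.2⟩)
    exact hm ⟨le_rfl, ht.1⟩ ⟨ht.1, le_rfl⟩ ht.1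
  refine key b ⟨hab, le_rfl⟩ ?_
  by_contra! hcon
  obtain ⟨s, hs, hs0⟩ := hcon
  set S := Icc a b ∩ d ⁻¹' Iic 0 with hS
  have hScl : IsClosed S := hc.preimage_isClosed_of_isClosed isClosed_Icc isClosed_Iic
  have hSne : S.Nonempty := ⟨s, ⟨hs.1, hs.2.le⟩, hs0.le⟩
  have hSb : BddBelow S := ⟨a, fun x hx => hx.1.1⟩
  have hmem := hScl.csInf_mem hSne hSb
  have h1 := key _ hmem.1 (fun r hr => by
    by_contra! hr0
    have : r ∈ S := ⟨⟨hr.1, hr.2.le.trans hmem.1.2⟩, hr0.le⟩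
    exact absurd (csInf_le hSb this) (not_le.2 hr.2))
  have h2 : d (sInf S) ≤ 0 := hmem.2
  linarith

/-- Backward comparison for the dissipative equations `y' = Φ(y) - f`. -/
theorem backward_comparison {a b η : ℝ} {f Φ₁ Φ₂ y₁ y₂ : ℝ → ℝ} (hΦ : Monotone Φ₁)
    (hη : ∀ y, Φ₁ y ≤ Φ₂ y + η)  (hη0 : 0 ≤ η)
    (h₁ : ∀ t ∈ Icc a b, HasDerivWithinAt y₁ (Φ₁ (y₁ t) - f t) (Icc a b) t)
    (h₂ : ∀ t ∈ Icc a b, HasDerivWithinAt y₂ (Φ₂ (y₂ t) - f t) (Icc a b) t)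
    (hb : y₂ b ≤ y₁ b) : ∀ t ∈ Icc a b, y₂ t ≤ y₁ t + η * (b - t) := by
  intro t ht
  by_contra! hcon
  have hsub : Icc t b ⊆ Icc a b := Icc_subset_Icc_left ht.1
  have := le_of_deriv_nonneg_of_nonneg (d := fun s => y₂ s - y₁ s - η * (b - s))
    (d' := fun s => (Φ₂ (y₂ s) - f s) - (Φ₁ (y₁ s) - f s) - η * (0 - 1)) ht.2 (fun s hs => by
      have e := ((hasDerivWithinAt_const s (Icc t b) b).sub (hasDerivWithinAt_id s _)).const_mul η
      exact (((h₂ s (hsub hs)).mono hsub).sub ((h₁ s (hsub hs)).mono hsub)).sub e)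
    (by linarith) (fun s hs (h0 : 0 ≤ y₂ s - y₁ s - η * (b - s)) => by
      have h3 : 0 ≤ η * (b - s) := mul_nonneg hη0 (by linarith [hs.2])
      have := hΦ (show y₁ s ≤ y₂ s by linarith)
      have := hη (y₂ s)
      linarith)
  simp only [sub_self, mul_zero] at this
  linarith

/-- Compactness of `s ×ˢ s` reduces this to a local bound for pairs. Near the diagonal it is the
local Lipschitz property; off it, `|x - y|` is bounded below while the increment of `f` stays
bounded. -/
theorem LocallyLipschitzOn.exists_abs_sub_le {f : ℝ → ℝ} {s : Set ℝ} (hs : IsCompact s)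
    (hf : LocallyLipschitzOn s f) :
    ∃ K : ℝ, 0 < K ∧ ∀ x ∈ s, ∀ y ∈ s, |f x - f y| ≤ K * |x - y| := by
  have hc : ContinuousOn f s := hf.continuousOn
  have := (hs.prod hs).induction_on
    (p := fun t => ∃ K : ℝ, 0 < K ∧ ∀ z ∈ t ∩ s ×ˢ s, |f z.1 - f z.2| ≤ K * |z.1 - z.2|)
    ⟨1, one_pos, by simp⟩
    (fun A B hAB ⟨K, hK, h⟩ => ⟨K, hK, fun z hz => h z ⟨hAB hz.1, hz.2⟩⟩)
    (fun A B ⟨K, hK, h⟩ ⟨K', hK', h'⟩ => ⟨K + K', by positivity, fun z hz => by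
      rcases hz with ⟨hz | hz, hzs⟩
      · have := h z ⟨hz, hzs⟩
        nlinarith [abs_nonneg (z.1 - z.2)]
      · have := h' z ⟨hz, hzs⟩
        nlinarith [abs_nonneg (z.1 - z.2)]⟩)
    ?_
  · obtain ⟨K, hK, h⟩ := this
    exact ⟨K, hK, fun x hx y hy => h (x, y) ⟨⟨hx, hy⟩, hx, hy⟩⟩
  · rintro ⟨x, y⟩ ⟨hx, hy⟩
    simp only at hx hy
    rcases eq_or_ne x y with rfl | hxy
    · obtain ⟨K, t, ht, hK⟩ := hf hx
      refine ⟨t ×ˢ t, ?_, K + 1, by positivity, ?_⟩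
      · rw [nhdsWithin_prod_eq]; exact prod_mem_prod ht ht
      · rintro ⟨z, w⟩ ⟨⟨hz, hw⟩, -⟩
        have := hK.dist_le_mul z hz w hw
        rw [Real.dist_eq, Real.dist_eq] at this
        simp only
        nlinarith [abs_nonneg (z - w)]
    · have hd : 0 < |x - y| := abs_pos.2 (sub_ne_zero.2 hxy)
      have c1 : ContinuousWithinAt (fun z : ℝ × ℝ => |f z.1 - f z.2|) (s ×ˢ s) (x, y) :=
        (((hc x hx).comp continuousWithinAt_fst (fun z hz => hz.1)).sub
          ((hc y hy).comp continuousWithinAt_snd (fun z hz => hz.2))).abs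
      have c2 : ContinuousWithinAt
          (fun z : ℝ × ℝ => (|f x - f y| + 1) / (|x - y| / 2) * |z.1 - z.2|) (s ×ˢ s) (x, y) := by
        fun_prop
      have hlt : |f x - f y| < (|f x - f y| + 1) / (|x - y| / 2) * |x - y| := by
        have : (|f x - f y| + 1) / (|x - y| / 2) * |x - y| = 2 * (|f x - f y| + 1) := by
          field_simp
        rw [this]; linarith [abs_nonneg (f x - f y)]
      -- The constant makes the inequality strict at `(x, y)`, so by continuity it persists nearby.
      refine ⟨_, Filter.Tendsto.eventually_lt c1 c2 hlt, (|f x - f y| + 1) / (|x - y| / 2),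
        by positivity, fun z hz => hz.1.le⟩

/-! ### The slope function -/

/-- The slope `v'` of a front as a function of `y = ε (1 / √(1 - v'²) - 1)`. -/
noncomputable def frontSlope (ε y : ℝ) : ℝ := √(y * (2 * ε + y)) / (ε + y)

theorem frontSlope_zero (ε : ℝ) : frontSlope ε 0 = 0 := by simp [frontSlope]

section
variable {ε y z : ℝ}

theorem frontSlope_nonneg (hε : 0 < ε) (hy : 0 ≤ y) : 0 ≤ frontSlope ε y := by
  unfold frontSlope; positivity

theorem frontSlope_pos (hε : 0 < ε) (hy : 0 < y) : 0 < frontSlope ε y := by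
  unfold frontSlope; positivity

theorem frontSlope_sq (hε : 0 < ε) (hy : 0 ≤ y) :
    frontSlope ε y ^ 2 = 1 - (ε / (ε + y)) ^ 2 := by
  unfold frontSlope
  rw [div_pow, Real.sq_sqrt (by positivity)]
  field_simp
  ring

theorem frontSlope_lt_one (hε : 0 < ε) (hy : 0 ≤ y) : frontSlope ε y < 1 := by
  have h := frontSlope_sq hε hy
  have : 0 < (ε / (ε + y)) ^ 2 := by positivity
  nlinarith [frontSlope_nonneg hε hy]

theorem frontSlope_le_frontSlope (hε : 0 < ε) (hy : 0 ≤ y) (hyz : y ≤ z) :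
    frontSlope ε y ≤ frontSlope ε z := by
  have hz := hy.trans hyz
  refine le_of_sq_le_sq ?_ (frontSlope_nonneg hε hz)
  rw [frontSlope_sq hε hy, frontSlope_sq hε hz]
  gcongr

theorem monotone_frontSlope_max {δ : ℝ} (hε : 0 < ε) (hδ : 0 ≤ δ) :
    Monotone fun y => frontSlope ε (max y δ) := fun _ _ h =>
  frontSlope_le_frontSlope hε (hδ.trans (le_max_right _ _)) (max_le_max_right _ h)

theorem continuous_frontSlope_max {δ : ℝ} (hε : 0 < ε) (hδ : 0 ≤ δ) :
    Continuous fun y => frontSlope ε (max y δ) := by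
  unfold frontSlope
  refine Continuous.div (by fun_prop) (by fun_prop) fun y => ?_
  have := hδ.trans (le_max_right y δ)
  positivity

theorem continuousOn_frontSlope (hε : 0 < ε) : ContinuousOn (frontSlope ε) (Ici 0) := by
  refine (continuous_frontSlope_max hε le_rfl).continuousOn.congr fun y hy => ?_
  simp only [max_eq_left (mem_Ici.1 hy)]

theorem frontSlope_max_bounds {δ : ℝ} (hε : 0 < ε) (hδ : 0 ≤ δ) (y : ℝ) :
    frontSlope ε (max y 0) ≤ frontSlope ε (max y δ) ∧
    frontSlope ε (max y δ) ≤ frontSlope ε (max y 0) + frontSlope ε δ := by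
  refine ⟨frontSlope_le_frontSlope hε (le_max_right _ _) (max_le_max_left _ hδ), ?_⟩
  have h0 := frontSlope_nonneg hε hδ
  have h1 := frontSlope_nonneg hε (le_max_right y 0)
  rcases le_total y δ with h | h
  · rw [max_eq_right h]; linarith
  · rw [max_eq_left h, max_eq_left (hδ.trans h)]; linarith

/-- The squares of the slopes differ by at most `2 (a - b) / ε`; dividing by the sum of the slopes,
at least `2 * frontSlope ε δ`, gives the constant. It blows up as `δ → 0`. -/
theorem exists_lipschitz_frontSlope_max {δ : ℝ} (hε : 0 < ε) (hδ : 0 < δ) :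
    ∃ K : NNReal, LipschitzWith K fun y => frontSlope ε (max y δ) := by
  have hm := frontSlope_pos hε hδ
  have hK : 0 ≤ 1 / (ε * frontSlope ε δ) := by positivity
  refine ⟨⟨_, hK⟩, LipschitzWith.of_le_add_mul _ fun x y => ?_⟩
  change frontSlope ε (max x δ) ≤ frontSlope ε (max y δ) + 1 / (ε * frontSlope ε δ) * dist x y
  set a := max x δ with ha
  set b := max y δ with hb
  have ha0 : δ ≤ a := le_max_right _ _
  have hb0 : δ ≤ b := le_max_right _ _
  have hab : |a - b| ≤ |x - y| := abs_max_sub_max_le_abs x y δ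
  have h1 := frontSlope_le_frontSlope hε hδ.le ha0
  have h2 := frontSlope_le_frontSlope hε hδ.le hb0
  rw [Real.dist_eq, ← sub_le_iff_le_add']
  rcases le_total a b with h | h
  · have := frontSlope_le_frontSlope hε (hδ.le.trans ha0) h
    have : 0 ≤ 1 / (ε * frontSlope ε δ) * |x - y| := by positivity
    linarith
  · have e : frontSlope ε a ^ 2 - frontSlope ε b ^ 2 ≤ 2 * ((a - b) / ε) := by
      rw [frontSlope_sq hε (hδ.le.trans ha0), frontSlope_sq hε (hδ.le.trans hb0)]
      have ha1 : 0 < ε + a := by linarith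
      have hb1 : 0 < ε + b := by linarith
      have p1 : ε / (ε + b) ≤ 1 := (div_le_one hb1).2 (by linarith)
      have p2 : ε / (ε + a) ≤ 1 := (div_le_one ha1).2 (by linarith)
      have p3 : ε / (ε + b) - ε / (ε + a) ≤ (a - b) / ε := by
        rw [div_sub_div _ _ hb1.ne' ha1.ne', div_le_div_iff₀ (by positivity) hε]
        nlinarith [mul_nonneg (sub_nonneg.2 h) (show 0 ≤ (ε + b) * (ε + a) - ε * ε by nlinarith)]
      have p4 : 0 ≤ (a - b) / ε := div_nonneg (by linarith) hε.le
      have p5 : 0 < ε / (ε + b) := by positivity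
      have p6 : 0 < ε / (ε + a) := by positivity
      nlinarith
    have h3 : (a - b) / ε ≤ |x - y| / ε := by
      gcongr
      exact (le_abs_self _).trans hab
    have h4 : 1 / (ε * frontSlope ε δ) * |x - y| = |x - y| / ε / frontSlope ε δ := by
      field_simp
    rw [h4, le_div_iff₀ hm]
    have := frontSlope_le_frontSlope hε (hδ.le.trans hb0) h
    nlinarith

/-- The value of `y` with momentum `r` is `√(ε² + r²) - ε`; this rewrites the slope in terms of the
momentum. -/
theorem frontSlope_sqrt_sub (hε : 0 < ε) {r : ℝ} (hr : 0 ≤ r) :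
    frontSlope ε (√(ε ^ 2 + r ^ 2) - ε) = r / √(ε ^ 2 + r ^ 2) := by
  have hs : √(ε ^ 2 + r ^ 2) ^ 2 = ε ^ 2 + r ^ 2 := Real.sq_sqrt (by positivity)
  unfold frontSlope
  rw [show (√(ε ^ 2 + r ^ 2) - ε) * (2 * ε + (√(ε ^ 2 + r ^ 2) - ε)) = r ^ 2 by nlinarith,
    Real.sqrt_sq hr]
  congr 1; ring

/-- `ε s / √(1 - s²)` recovers the momentum `√(y (2ε + y))` from the slope. -/
theorem momentum_frontSlope (hε : 0 < ε) (hy : 0 ≤ y) :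
    ε * (frontSlope ε y / √(1 - frontSlope ε y ^ 2)) = √(y * (2 * ε + y)) := by
  rw [frontSlope_sq hε hy, sub_sub_cancel, Real.sqrt_sq (by positivity)]
  unfold frontSlope
  field_simp

theorem tendsto_frontSlope (hy : 0 < y) : Tendsto (fun ε => frontSlope ε y) (𝓝[>] 0) (𝓝 1) := by
  have : ContinuousAt (fun ε => frontSlope ε y) 0 := by
    unfold frontSlope
    refine ContinuousAt.div (by fun_prop) (by fun_prop) (by simp [hy.ne'])
  have h := this.tendsto
  have e : frontSlope 0 y = 1 := by
    unfold frontSlope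
    rw [mul_zero, zero_add, Real.sqrt_mul_self hy.le, div_self hy.ne']
  rw [e] at h
  exact h.mono_left nhdsWithin_le_nhds

theorem tendsto_frontSlope_zero (hε : 0 < ε) : Tendsto (frontSlope ε) (𝓝[>] 0) (𝓝 0) := by
  have h := (continuousOn_frontSlope hε 0 self_mem_Ici).tendsto
  rw [frontSlope_zero] at h
  exact h.mono_left (nhdsWithin_mono _ Ioi_subset_Ici_self)
end

/-! ### Backward solvability from `v = 1` -/

theorem exists_backward_solution_of_lipschitz {Φ f : ℝ → ℝ} {K : NNReal} {M : ℝ}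
    (hΦ : LipschitzWith K Φ) (hM : ∀ y, |Φ y| ≤ M) (hf : Continuous f) :
    ∃ y : ℝ → ℝ, y 1 = 0 ∧
      ∀ t ∈ Icc (0 : ℝ) 1, HasDerivWithinAt y (Φ (y t) - f t) (Icc 0 1) t := by
  obtain ⟨B, hB⟩ := isCompact_Icc.exists_bound_of_continuousOn (hf.continuousOn (s := Icc 0 1))
  have hL : 0 ≤ M + B := add_nonneg ((abs_nonneg _).trans (hM 0))
    ((norm_nonneg _).trans (hB 0 ⟨le_rfl, zero_le_one⟩))
  let L : NNReal := ⟨M + B, hL⟩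
  have hPL : IsPicardLindelof (fun t x => Φ x - f t) (tmin := 0) (tmax := 1)
      ⟨1, zero_le_one, le_rfl⟩ 0 L 0 L K :=
    { lipschitzOnWith := fun t _ => by
        refine LipschitzOnWith.of_dist_le_mul fun x _ y _ => ?_
        rw [dist_sub_right]
        exact hΦ.dist_le_mul x y
      continuousOn := fun x _ => (continuous_const.sub hf).continuousOn
      norm_le := fun t ht x _ => (norm_sub_le _ _).trans (add_le_add (hM x) (hB t ht))
      mul_max_le := by simp }
  exact hPL.exists_eq_forall_mem_Icc_hasDerivWithinAt₀

theorem eq_integral_of_hasDerivWithinAt {y g : ℝ → ℝ} (h1 : y 1 = 0)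
    (hg : ContinuousOn g (Icc 0 1))
    (hy : ∀ t ∈ Icc (0 : ℝ) 1, HasDerivWithinAt y (g t) (Icc 0 1) t) :
    ∀ t ∈ Icc (0 : ℝ) 1, y t = ∫ s in (1 : ℝ)..t, g s := by
  intro t ht
  have hsub : Icc t 1 ⊆ Icc 0 1 := Icc_subset_Icc_left ht.1
  have := intervalIntegral.integral_eq_sub_of_hasDerivAt_of_le ht.2 (f := y) (f' := g)
    (fun s hs => ((hy s (hsub hs)).continuousWithinAt).mono hsub)
    (fun s hs => (hy s (hsub ⟨hs.1.le, hs.2.le⟩)).hasDerivAt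
      (Icc_mem_nhds (ht.1.trans_lt hs.1) hs.2))
    ((hg.mono hsub).intervalIntegrable_of_Icc ht.2)
  rw [intervalIntegral.integral_symm, this, h1]
  ring

theorem hasDerivWithinAt_of_eq_integral {y g : ℝ → ℝ} (hg : ContinuousOn g (Icc 0 1))
    (hy : ∀ t ∈ Icc (0 : ℝ) 1, y t = ∫ s in (1 : ℝ)..t, g s) :
    ∀ t ∈ Icc (0 : ℝ) 1, HasDerivWithinAt y (g t) (Icc 0 1) t := by
  intro t ht
  set G : ℝ → ℝ := IccExtend zero_le_one ((Icc (0 : ℝ) 1).domRestrict g) with hG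
  have hGc : Continuous G := (continuousOn_iff_continuous_domRestrict.1 hg).Icc_extend'
  have hGe : ∀ s ∈ Icc (0 : ℝ) 1, G s = g s := fun s hs => by
    rw [hG, IccExtend_of_mem _ _ hs, domRestrict_apply]
  have e : ∀ t ∈ Icc (0 : ℝ) 1, y t = ∫ s in (1 : ℝ)..t, G s := fun t ht => by
    rw [hy t ht]
    refine intervalIntegral.integral_congr fun s hs => ?_
    rw [uIcc_of_ge ht.2] at hs
    exact (hGe s ⟨ht.1.trans hs.1, hs.2⟩).symm
  have hd := (hGc.integral_hasStrictDerivAt 1 t).hasDerivAt.hasDerivWithinAt (s := Icc 0 1)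
  rw [hGe t ht] at hd
  exact hd.congr e (e t ht)

/-- Backward solvability of `y' = Φ(y) - f`, `y(1) = 0`, for a monotone `Φ` that is a uniform limit
of monotone Lipschitz functions. -/
theorem exists_backward_solution {Φ f : ℝ → ℝ} {Φn : ℕ → ℝ → ℝ} {e : ℕ → ℝ} {M : ℝ}
    (hΦ : Continuous Φ) (hf : Continuous f) (hmono : ∀ n, Monotone (Φn n))
    (hlip : ∀ n, ∃ K, LipschitzWith K (Φn n)) (hM : ∀ n y, |Φn n y| ≤ M)
    (he : ∀ n y, |Φn n y - Φ y| ≤ e n) (he0 : Tendsto e atTop (𝓝 0)) :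
    ∃ y : ℝ → ℝ, y 1 = 0 ∧
      ∀ t ∈ Icc (0 : ℝ) 1, HasDerivWithinAt y (Φ (y t) - f t) (Icc 0 1) t := by
  have hen : ∀ n, 0 ≤ e n := fun n => (abs_nonneg _).trans (he n 0)
  choose Y hY1 hY using fun n =>
    (hlip n).elim fun K hK => exists_backward_solution_of_lipschitz hK (hM n) hf
  -- Backward comparison uses only monotonicity, so this bound does not involve the Lipschitz
  -- constants, which may blow up with `n`.
  have hcl : ∀ n m, ∀ t ∈ Icc (0 : ℝ) 1, Y m t ≤ Y n t + (e n + e m) := by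
    intro n m t ht
    have hnm : 0 ≤ e n + e m := add_nonneg (hen n) (hen m)
    have := backward_comparison (hmono n) (Φ₂ := Φn m) (η := e n + e m) (fun y => by
      linarith [(abs_le.1 (he n y)).2, (abs_le.1 (he m y)).1]) hnm (hY n) (hY m)
      (by rw [hY1, hY1]) t ht
    nlinarith [ht.1]
  have hcauchy : ∀ t ∈ Icc (0 : ℝ) 1, ∃ l, Tendsto (fun n => Y n t) atTop (𝓝 l) := by
    intro t ht
    refine cauchySeq_tendsto_of_complete (cauchySeq_of_le_tendsto_0 (fun N => 2 * sSup (e '' Ici N))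
      (fun n m N hn hm => ?_) ?_)
    · have hb : BddAbove (e '' Ici N) := he0.bddAbove_range.mono (image_subset_range _ _)
      have h1 := le_csSup hb (mem_image_of_mem e (mem_Ici.2 hn))
      have h2 := le_csSup hb (mem_image_of_mem e (mem_Ici.2 hm))
      rw [Real.dist_eq, abs_le]
      constructor <;> linarith [hcl n m t ht, hcl m n t ht]
    · rw [Metric.tendsto_atTop]
      intro δ hδ
      obtain ⟨N, hN⟩ := Metric.tendsto_atTop.1 he0 (δ / 4) (by linarith)
      refine ⟨N, fun n hn => ?_⟩
      have h0 : sSup (e '' Ici n) ≤ δ / 4 := csSup_le (nonempty_Ici.image e) (by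
        rintro _ ⟨m, hm, rfl⟩
        have := hN m (hn.trans hm)
        rw [Real.dist_eq, sub_zero] at this
        exact (le_abs_self _).trans this.le)
      have h1 : 0 ≤ sSup (e '' Ici n) := Real.sSup_nonneg (by rintro _ ⟨m, -, rfl⟩; exact hen m)
      rw [Real.dist_eq, sub_zero, abs_of_nonneg (by linarith)]
      linarith
  choose! y hy using hcauchy
  have hyc : ContinuousOn y (Icc 0 1) := by
    refine TendstoUniformlyOn.continuousOn (F := Y) (p := atTop) ?_
      (Eventually.frequently (Eventually.of_forall fun n t ht => (hY n t ht).continuousWithinAt))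
    rw [Metric.tendstoUniformlyOn_iff]
    intro δ hδ
    filter_upwards [he0.eventually (gt_mem_nhds hδ)] with n hn t ht
    have h1 : y t ≤ Y n t + (e n + 0) :=
      le_of_tendsto_of_tendsto' (hy t ht) ((tendsto_const_nhds (x := e n)).add he0 |>.const_add _)
        fun m => hcl n m t ht
    have h2 : Y n t ≤ y t + (0 + e n) :=
      ge_of_tendsto' ((hy t ht).add (he0.add (tendsto_const_nhds (x := e n))))
        fun m => hcl m n t ht
    rw [Real.dist_eq, abs_lt]
    constructor <;> linarith
  -- Derivatives need not pass to the limit directly; the integral equation does, by dominated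
  -- convergence.
  have hint : ∀ t ∈ Icc (0 : ℝ) 1, y t = ∫ s in (1 : ℝ)..t, (Φ (y s) - f s) := by
    intro t ht
    obtain ⟨B, hB⟩ := isCompact_Icc.exists_bound_of_continuousOn (hf.continuousOn (s := Icc 0 1))
    have hsub : uIoc 1 t ⊆ Icc (0 : ℝ) 1 := by
      rw [uIoc_of_ge ht.2]
      exact fun s hs => ⟨ht.1.trans hs.1.le, hs.2⟩
    have hYc : ∀ n, ContinuousOn (fun s => Φn n (Y n s) - f s) (Icc 0 1) := fun n => by
      obtain ⟨K, hK⟩ := hlip n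
      exact (hK.continuous.comp_continuousOn fun t ht => (hY n t ht).continuousWithinAt).sub
        hf.continuousOn
    have h1 : Tendsto (fun n => ∫ s in (1 : ℝ)..t, (Φn n (Y n s) - f s)) atTop
        (𝓝 (∫ s in (1 : ℝ)..t, (Φ (y s) - f s))) := by
      refine intervalIntegral.tendsto_integral_filter_of_dominated_convergence (fun _ => M + B)
        (Eventually.of_forall fun n => ?_) (Eventually.of_forall fun n => ?_)
        intervalIntegrable_const ?_
      · exact ((hYc n).mono hsub).aestronglyMeasurable measurableSet_uIoc
      · exact Eventually.of_forall fun s hs =>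
          (norm_sub_le _ _).trans (add_le_add (hM n _) (hB s (hsub hs)))
      · refine Eventually.of_forall fun s hs => Tendsto.sub_const ?_ _
        have h2 : Tendsto (fun n => Φ (Y n s)) atTop (𝓝 (Φ (y s))) :=
          (hΦ.tendsto _).comp (hy s (hsub hs))
        have h3 : Tendsto (fun n => Φn n (Y n s) - Φ (Y n s)) atTop (𝓝 0) :=
          squeeze_zero_norm (fun n => he n _) he0
        simpa using h3.add h2
    refine tendsto_nhds_unique (hy t ht) (h1.congr fun n => ?_)
    exact (eq_integral_of_hasDerivWithinAt (hY1 n) (hYc n) (hY n) t ht).symm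
  refine ⟨y, ?_, hasDerivWithinAt_of_eq_integral
    ((hΦ.comp_continuousOn hyc).sub hf.continuousOn) hint⟩
  rw [hint 1 ⟨zero_le_one, le_rfl⟩, intervalIntegral.integral_same]

/-- Truncating the argument from below at `1 / (n + 1)` makes the slope Lipschitz and costs at most
`c * frontSlope ε (1 / (n + 1))` uniformly. -/
theorem exists_backward_frontSlope_solution {f : ℝ → ℝ} {ε c : ℝ} (hε : 0 < ε) (hc : 0 ≤ c)
    (hf : ContinuousOn f (Icc 0 1)) :
    ∃ y : ℝ → ℝ, y 1 = 0 ∧ ∀ t ∈ Icc (0 : ℝ) 1,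
      HasDerivWithinAt y (c * frontSlope ε (max (y t) 0) - f t) (Icc 0 1) t := by
  set G : ℝ → ℝ := IccExtend zero_le_one ((Icc (0 : ℝ) 1).domRestrict f) with hG
  have hGc : Continuous G := (continuousOn_iff_continuous_domRestrict.1 hf).Icc_extend'
  have hGe : ∀ s ∈ Icc (0 : ℝ) 1, G s = f s := fun s hs => by
    rw [hG, IccExtend_of_mem _ _ hs, domRestrict_apply]
  have hδ : ∀ n : ℕ, (0 : ℝ) < 1 / (n + 1) := fun n => Nat.one_div_pos_of_nat
  suffices h : ∃ y : ℝ → ℝ, y 1 = 0 ∧ ∀ t ∈ Icc (0 : ℝ) 1,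
      HasDerivWithinAt y (c * frontSlope ε (max (y t) 0) - G t) (Icc 0 1) t by
    obtain ⟨y, h1, hy⟩ := h
    exact ⟨y, h1, fun t ht => hGe t ht ▸ hy t ht⟩
  refine exists_backward_solution
    (Φ := fun y => c * frontSlope ε (max y 0)) (f := G)
    (Φn := fun n y => c * frontSlope ε (max y (1 / (n + 1))))
    (e := fun n => c * frontSlope ε (1 / (n + 1))) (M := c * 1)
    (continuous_const.mul (continuous_frontSlope_max hε le_rfl)) hGc
    (fun n => (monotone_frontSlope_max hε (hδ n).le).const_mul hc)
    (fun n => ?_) (fun n y => ?_) (fun n y => ?_) ?_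
  · obtain ⟨K, hK⟩ := exists_lipschitz_frontSlope_max hε (hδ n)
    exact ⟨_, (lipschitzWith_smul c).comp hK⟩
  · have h0 : (0 : ℝ) ≤ max y (1 / (n + 1)) := (hδ n).le.trans (le_max_right _ _)
    rw [abs_of_nonneg (mul_nonneg hc (frontSlope_nonneg hε h0))]
    exact mul_le_mul_of_nonneg_left (frontSlope_lt_one hε h0).le hc
  · obtain ⟨h2, h3⟩ := frontSlope_max_bounds hε (hδ n).le y
    rw [← mul_sub, abs_mul, abs_of_nonneg hc]
    refine mul_le_mul_of_nonneg_left ?_ hc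
    rw [abs_le]
    constructor <;> linarith [frontSlope_nonneg hε (hδ n).le]
  · have := (tendsto_frontSlope_zero hε).comp (tendsto_nhdsWithin_iff.2
      ⟨tendsto_one_div_add_atTop_nhds_zero_nat (𝕜 := ℝ), Eventually.of_forall hδ⟩)
    simpa using this.const_mul c

/-- Once negative, `y` obeys `y' = -f ≤ 0` and can never come back to `y(1) = 0`. -/
theorem nonneg_of_backward_solution {f Φ y : ℝ → ℝ} (hf : ∀ t ∈ Icc (0 : ℝ) 1, 0 ≤ f t)
    (hΦ : ∀ y ≤ 0, Φ y = 0) (h1 : y 1 = 0)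
    (hy : ∀ t ∈ Icc (0 : ℝ) 1, HasDerivWithinAt y (Φ (y t) - f t) (Icc 0 1) t) :
    ∀ t ∈ Icc (0 : ℝ) 1, 0 ≤ y t := by
  intro t ht
  by_contra! hcon
  have hsub : Icc t 1 ⊆ Icc 0 1 := Icc_subset_Icc_left ht.1
  have := le_of_deriv_nonneg_of_nonneg (d := fun s => - y s) ht.2
    (fun s hs => ((hy s (hsub hs)).mono hsub).neg) (by linarith) (fun s hs h0 => by
      have := hf s (hsub hs)
      rw [hΦ (y s) (by linarith)]
      linarith)
  linarith

/-- A zero of the nonnegative function `y` would be an interior minimum, where the equation forces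
the derivative `-f t < 0`. -/
theorem pos_of_backward_solution {f Φ y : ℝ → ℝ} (hf : ∀ t ∈ Icc (0 : ℝ) 1, 0 ≤ f t)
    (hΦ : ∀ y ≤ 0, Φ y = 0) (h1 : y 1 = 0)
    (hy : ∀ t ∈ Icc (0 : ℝ) 1, HasDerivWithinAt y (Φ (y t) - f t) (Icc 0 1) t)
    {t : ℝ} (ht : t ∈ Ioo (0 : ℝ) 1) (hft : 0 < f t) : 0 < y t := by
  have h0 := nonneg_of_backward_solution hf hΦ h1 hy
  refine (h0 t ⟨ht.1.le, ht.2.le⟩).lt_of_ne' fun hyt => ?_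
  have hmin : IsLocalMin y t := by
    filter_upwards [Icc_mem_nhds ht.1 ht.2] with s hs
    rw [hyt]; exact h0 s hs
  have := hmin.hasDerivAt_eq_zero ((hy t ⟨ht.1.le, ht.2.le⟩).hasDerivAt (Icc_mem_nhds ht.1 ht.2))
  rw [hΦ _ hyt.le] at this
  linarith

/-! ### The first-order problem and its unique admissible speed -/

theorem HypH.nonneg {f : ℝ → ℝ} {α : ℝ} (hH : HypH f) (hB : IsTypeB f α) :
    ∀ t ∈ Icc (0 : ℝ) 1, 0 ≤ f t := by
  intro t ht
  rcases le_or_gt t α with h | h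
  · exact (hB.eq_zero t ⟨ht.1, h⟩).ge
  · rcases ht.2.lt_or_eq with h' | rfl
    · exact (hB.pos t ⟨h, h'⟩).le
    · exact hH.map_one.ge

section
variable {f y : ℝ → ℝ} {α ε c : ℝ}

theorem IsFirstOrderSolution.nonneg (h : IsFirstOrderSolution f ε c y) :
    ∀ v ∈ Icc (0 : ℝ) 1, 0 ≤ y v := by
  intro v hv
  rcases hv.1.eq_or_lt with rfl | h0
  · exact h.map_zero.ge
  rcases hv.2.eq_or_lt with rfl | h1
  · exact h.map_one.ge
  · exact (h.pos v ⟨h0, h1⟩).le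

theorem IsFirstOrderSolution.hasDerivWithinAt (h : IsFirstOrderSolution f ε c y) :
    ∀ v ∈ Icc (0 : ℝ) 1, HasDerivWithinAt y (c * frontSlope ε (y v) - f v) (Icc 0 1) v := h.ode

theorem IsFirstOrderSolution.hasDerivAt (h : IsFirstOrderSolution f ε c y) :
    ∀ v ∈ Ioo (0 : ℝ) 1, HasDerivAt y (c * frontSlope ε (y v) - f v) v := fun v hv =>
  (h.ode v ⟨hv.1.le, hv.2.le⟩).hasDerivAt (Icc_mem_nhds hv.1 hv.2)

theorem IsFirstOrderSolution.continuousOn (h : IsFirstOrderSolution f ε c y) :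
    ContinuousOn y (Icc 0 1) := fun v hv => (h.ode v hv).continuousWithinAt

/-- The momentum `r = √(y (2ε + y))` satisfies `r' = c - f √(ε² + r²) / r`. -/
theorem IsFirstOrderSolution.hasDerivAt_momentum (hε : 0 < ε) (h : IsFirstOrderSolution f ε c y)
    {v : ℝ} (hv : v ∈ Ioo (0 : ℝ) 1) :
    HasDerivAt (fun v => √(y v * (2 * ε + y v))) (c - f v / frontSlope ε (y v)) v := by
  have hy := h.pos v hv
  have hd := h.hasDerivAt v hv
  have h1 := (hd.fun_mul (hd.const_add (2 * ε))).sqrt (by positivity)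
  convert h1 using 1
  have hg := frontSlope_pos hε hy
  have e : √(y v * (2 * ε + y v)) = frontSlope ε (y v) * (ε + y v) := by
    unfold frontSlope; field_simp
  rw [e]
  have : ε + y v ≠ 0 := by positivity
  field_simp
  ring

/-- Where `f` vanishes the momentum has constant derivative `c`, and it starts from `0`. -/
theorem IsFirstOrderSolution.momentum_eq (hε : 0 < ε) (hB : IsTypeB f α)
    (h : IsFirstOrderSolution f ε c y) {v : ℝ} (hv : v ∈ Icc 0 α) :
    √(y v * (2 * ε + y v)) = c * v := by
  have hα := hB.threshold_mem
  have hsub : Icc 0 α ⊆ Icc (0 : ℝ) 1 := Icc_subset_Icc_right hα.2.le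
  have hc : ContinuousOn (fun v => √(y v * (2 * ε + y v)) - c * v) (Icc 0 α) := by
    have := h.continuousOn.mono hsub
    fun_prop
  have hd : ∀ x ∈ interior (Icc 0 α),
      HasDerivWithinAt (fun v => √(y v * (2 * ε + y v)) - c * v) 0 (interior (Icc 0 α)) x := by
    intro x hx
    rw [interior_Icc] at hx
    have := (h.hasDerivAt_momentum hε ⟨hx.1, hx.2.trans hα.2⟩).fun_sub
      ((hasDerivAt_id x).const_mul c)
    rw [hB.eq_zero x ⟨hx.1.le, hx.2.le⟩] at this
    simpa using this.hasDerivWithinAt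
  have m1 := monotoneOn_of_hasDerivWithinAt_nonneg (convex_Icc 0 α) hc hd fun _ _ => le_rfl
  have m2 := antitoneOn_of_hasDerivWithinAt_nonpos (convex_Icc 0 α) hc hd fun _ _ => le_rfl
  have h0 : (0 : ℝ) ∈ Icc 0 α := ⟨le_rfl, hα.1.le⟩
  have e := le_antisymm (m1 h0 hv hv.1) (m2 h0 hv hv.1)
  simp only [h.map_zero, zero_mul, Real.sqrt_zero, mul_zero, sub_zero] at e
  linarith

theorem IsFirstOrderSolution.speed_pos (hε : 0 < ε) (hB : IsTypeB f α)
    (h : IsFirstOrderSolution f ε c y) : 0 < c := by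
  have hα := hB.threshold_mem
  have e := h.momentum_eq hε hB (v := α) ⟨hα.1.le, le_rfl⟩
  have hy := h.pos α hα
  have : 0 < c * α := by rw [← e]; positivity
  exact pos_of_mul_pos_left this hα.1.le

theorem IsFirstOrderSolution.eq_sqrt_sub (hε : 0 < ε) (hB : IsTypeB f α)
    (h : IsFirstOrderSolution f ε c y) {v : ℝ} (hv : v ∈ Icc 0 α) :
    y v = √(ε ^ 2 + (c * v) ^ 2) - ε := by
  have hy := h.nonneg v ⟨hv.1, hv.2.trans hB.threshold_mem.2.le⟩
  rw [← h.momentum_eq hε hB hv, Real.sq_sqrt (by positivity),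
    show ε ^ 2 + y v * (2 * ε + y v) = (ε + y v) ^ 2 by ring, Real.sqrt_sq (by positivity)]
  ring

/-- A faster solution is strictly higher at `α` by the explicit formula, and monotonicity of the
slope keeps the gap from shrinking up to `1`, where both vanish. Exchanging the roles gives
uniqueness of the speed. -/
theorem IsFirstOrderSolution.speed_le (hε : 0 < ε) (hB : IsTypeB f α) {c' : ℝ} {y' : ℝ → ℝ}
    (h : IsFirstOrderSolution f ε c y) (h' : IsFirstOrderSolution f ε c' y') : c' ≤ c := by
  by_contra! hlt
  have hα := hB.threshold_mem
  have hα' : α ∈ Icc 0 α := ⟨hα.1.le, le_rfl⟩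
  have hc := h.speed_pos hε hB
  have hsub : Icc α 1 ⊆ Icc (0 : ℝ) 1 := Icc_subset_Icc_left hα.1.le
  have h0 : 0 < y' α - y α := by
    rw [h.eq_sqrt_sub hε hB hα', h'.eq_sqrt_sub hε hB hα', sub_sub_sub_cancel_right, sub_pos]
    have := hα.1
    gcongr
  have := le_of_deriv_nonneg_of_nonneg (d := fun v => y' v - y v) hα.2.le
    (fun v hv => ((h'.hasDerivWithinAt v (hsub hv)).mono hsub).sub
      ((h.hasDerivWithinAt v (hsub hv)).mono hsub)) h0 (fun v hv hv0 => by
      have h1 := frontSlope_le_frontSlope hε (h.nonneg v (hsub hv)) (sub_nonneg.1 hv0)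
      have h2 := frontSlope_nonneg hε (h.nonneg v (hsub hv))
      nlinarith)
  simp only [h.map_one, h'.map_one] at this
  linarith

theorem hasDerivAt_sqrt_sub (hε : 0 < ε) (c v : ℝ) :
    HasDerivAt (fun v => √(ε ^ 2 + (c * v) ^ 2) - ε)
      (c * (c * v / √(ε ^ 2 + (c * v) ^ 2))) v := by
  have h1 := (((((hasDerivAt_id v).const_mul c).fun_pow 2).const_add (ε ^ 2)).sqrt
    (by simp only [id]; positivity)).sub_const ε
  refine h1.congr_deriv ?_
  have : √(ε ^ 2 + (c * v) ^ 2) ≠ 0 := by positivity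
  simp only [id, Nat.cast_ofNat, Nat.reduceSub, pow_one]
  field_simp

/-- Shooting: `Y c α`, obtained backward from `1`, is continuous in `c` and bounded, while the value
at `α` dictated by the data at `0` grows without bound. The two agree for some `c`. -/
theorem exists_isFirstOrderSolution (hε : 0 < ε) (hH : HypH f) (hB : IsTypeB f α) :
    ∃ c y, IsFirstOrderSolution f ε c y := by
  have hα := hB.threshold_mem
  have hα01 : α ∈ Icc (0 : ℝ) 1 := ⟨hα.1.le, hα.2.le⟩
  have hf0 := hH.nonneg hB
  have hmono := monotone_frontSlope_max hε (le_refl 0)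
  have hΦ0 : ∀ c y : ℝ, y ≤ 0 → c * frontSlope ε (max y 0) = 0 := fun c y hy => by
    rw [max_eq_right hy, frontSlope_zero, mul_zero]
  have hs0 : ∀ y, 0 ≤ frontSlope ε (max y 0) := fun y => frontSlope_nonneg hε (le_max_right _ _)
  have hs1 : ∀ y, frontSlope ε (max y 0) ≤ 1 := fun y =>
    (frontSlope_lt_one hε (le_max_right _ _)).le
  choose! Y hY1 hY using fun c (hc : 0 ≤ c) =>
    exists_backward_frontSlope_solution hε hc hH.continuousOn
  have hYpos : ∀ c, 0 ≤ c → ∀ t ∈ Ioo α 1, 0 < Y c t := fun c hc t ht =>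
    pos_of_backward_solution (Φ := fun y => c * frontSlope ε (max y 0)) hf0 (hΦ0 c) (hY1 c hc)
      (hY c hc) ⟨hα.1.trans ht.1, ht.2⟩ (hB.pos t ht)
  have hYnn : ∀ c, 0 ≤ c → ∀ t ∈ Icc (0 : ℝ) 1, 0 ≤ Y c t := fun c hc =>
    nonneg_of_backward_solution (Φ := fun y => c * frontSlope ε (max y 0)) hf0 (hΦ0 c) (hY1 c hc)
      (hY c hc)
  have hlip : ∀ c, 0 ≤ c → ∀ c', 0 ≤ c' → Y c' α ≤ Y c α + |c - c'| := by
    intro c hc c' hc'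
    have := backward_comparison (η := |c - c'|) (hmono.const_mul hc)
      (Φ₂ := fun y => c' * frontSlope ε (max y 0)) (fun y => by
        have := le_abs_self (c - c')
        nlinarith [hs0 y, hs1 y, abs_nonneg (c - c')]) (abs_nonneg _) (hY c hc) (hY c' hc')
      (by rw [hY1 c hc, hY1 c' hc']) α hα01
    nlinarith [abs_nonneg (c - c'), hα.1]
  have hcont : ContinuousOn (fun c => Y c α) (Ici 0) := by
    refine LipschitzOnWith.continuousOn (K := 1) (LipschitzOnWith.of_le_add_mul 1 ?_)
    intro c hc c' hc'
    rw [NNReal.coe_one, one_mul, Real.dist_eq, abs_sub_comm]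
    exact hlip c' hc' c hc
  obtain ⟨B, hB'⟩ := isCompact_Icc.exists_bound_of_continuousOn hH.continuousOn
  have hB0 : 0 ≤ B := (norm_nonneg _).trans (hB' α hα01)
  have hYB : ∀ c, 0 ≤ c → Y c α ≤ B := by
    intro c hc
    have hm : MonotoneOn (fun t => Y c t + B * t) (Icc 0 1) := by
      refine monotoneOn_of_hasDerivWithinAt_nonneg
        (f' := fun t => c * frontSlope ε (max (Y c t) 0) - f t + B * 1) (convex_Icc 0 1)
        (fun t ht => ?_) (fun t ht => ?_) (fun t ht => ?_)
      · exact ((hY c hc t ht).continuousWithinAt).add (by fun_prop)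
      · exact ((hY c hc t (interior_subset ht)).mono interior_subset).add
          ((hasDerivWithinAt_id t _).const_mul B)
      · have := (abs_le.1 (hB' t (interior_subset ht))).2
        have := mul_nonneg hc (hs0 (Y c t))
        linarith
    have := hm hα01 ⟨zero_le_one, le_rfl⟩ hα.2.le
    simp only [hY1 c hc] at this
    nlinarith [hα.1]
  -- At this speed `c α = B + ε`, so the explicit value `√(ε² + (c α)²) - ε` is at least `B`, hence
  -- at least `Y c α`.
  have hC : 0 ≤ (B + ε) / α := by have := hα.1; positivity
  obtain ⟨c, hc, hce⟩ : ∃ c ∈ Icc 0 ((B + ε) / α), Y c α - (√(ε ^ 2 + (c * α) ^ 2) - ε) = 0 := by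
    refine intermediate_value_Icc' hC
      (f := fun c => Y c α - (√(ε ^ 2 + (c * α) ^ 2) - ε)) ?_ ⟨?_, ?_⟩
    · have := hcont.mono (Icc_subset_Ici_self : Icc 0 ((B + ε) / α) ⊆ Ici 0)
      fun_prop
    · have h1 := hYB _ hC
      have h2 : (B + ε) / α * α ≤ √(ε ^ 2 + ((B + ε) / α * α) ^ 2) :=
        Real.le_sqrt_of_sq_le (by nlinarith [sq_nonneg ε])
      rw [div_mul_cancel₀ _ hα.1.ne'] at h2
      rw [div_mul_cancel₀ _ hα.1.ne']
      linarith
    · have := hYnn 0 le_rfl α hα01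
      simpa [Real.sqrt_sq hε.le] using this
  -- With `c = 0` the matching gives `Y 0 α = 0` while `Y 0` is nonincreasing, against positivity on
  -- `(α, 1)`.
  have hc0 : 0 < c := by
    refine hc.1.lt_of_ne fun h0 => ?_
    subst h0
    simp only [zero_mul, ne_eq, OfNat.ofNat_ne_zero, not_false_eq_true, zero_pow, add_zero,
      Real.sqrt_sq hε.le, sub_self, sub_zero] at hce
    have hanti : AntitoneOn (Y 0) (Icc 0 1) := by
      refine antitoneOn_of_hasDerivWithinAt_nonpos
        (f' := fun t => 0 * frontSlope ε (max (Y 0 t) 0) - f t) (convex_Icc 0 1)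
        (fun t ht => (hY 0 le_rfl t ht).continuousWithinAt)
        (fun t ht => (hY 0 le_rfl t (interior_subset ht)).mono interior_subset) fun t ht => ?_
      linarith [hf0 t (interior_subset ht)]
    have hm : (α + 1) / 2 ∈ Ioo α 1 := ⟨by linarith [hα.2], by linarith [hα.2]⟩
    have := hanti hα01 ⟨hα.1.le.trans hm.1.le, hm.2.le⟩ hm.1.le
    linarith [hYpos 0 le_rfl _ hm]
  -- Both sides solve the same equation on `[0, α]` and agree at `α`; backward comparison in both
  -- directions with `η = 0` identifies them.
  have hexp : ∀ v ∈ Icc 0 α, Y c v = √(ε ^ 2 + (c * v) ^ 2) - ε := by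
    have hsub : Icc 0 α ⊆ Icc (0 : ℝ) 1 := Icc_subset_Icc_right hα.2.le
    have h1 : ∀ t ∈ Icc 0 α, HasDerivWithinAt (Y c)
        (c * frontSlope ε (max (Y c t) 0) - f t) (Icc 0 α) t := fun t ht =>
      (hY c hc.1 t (hsub ht)).mono hsub
    have h2 : ∀ t ∈ Icc 0 α, HasDerivWithinAt (fun v => √(ε ^ 2 + (c * v) ^ 2) - ε)
        (c * frontSlope ε (max (√(ε ^ 2 + (c * t) ^ 2) - ε) 0) - f t) (Icc 0 α) t := by
      intro t ht
      have h0 : 0 ≤ √(ε ^ 2 + (c * t) ^ 2) - ε :=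
        sub_nonneg.2 (Real.le_sqrt_of_sq_le (by nlinarith [sq_nonneg (c * t)]))
      rw [max_eq_left h0, frontSlope_sqrt_sub hε (mul_nonneg hc.1 ht.1), hB.eq_zero t ht, sub_zero]
      exact (hasDerivAt_sqrt_sub hε c t).hasDerivWithinAt
    have hm := hmono.const_mul hc.1
    intro v hv
    have hce' : Y c α = √(ε ^ 2 + (c * α) ^ 2) - ε := by linarith
    have e1 := backward_comparison hm (fun y => (add_zero _).ge) le_rfl h1 h2 hce'.ge v hv
    have e2 := backward_comparison hm (fun y => (add_zero _).ge) le_rfl h2 h1 hce'.le v hv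
    linarith
  refine ⟨c, Y c, fun v hv => ?_, ?_, hY1 c hc.1, fun v hv => ?_⟩
  · have := hY c hc.1 v hv
    rwa [max_eq_left (hYnn c hc.1 v hv)] at this
  · rw [hexp 0 ⟨le_rfl, hα.1.le⟩]
    simp [Real.sqrt_sq hε.le]
  · rcases le_or_gt v α with h | h
    · rw [hexp v ⟨hv.1.le, h⟩, sub_pos]
      have := mul_pos hc0 hv.1
      exact Real.lt_sqrt_of_sq_lt (by nlinarith)
    · exact hYpos c hc.1 v ⟨h, hv.2⟩

theorem setOf_isAdmissibleSpeed_eq (hε : 0 < ε) (hH : HypH f) (hB : IsTypeB f α) :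
    {c : ℝ | IsAdmissibleSpeed f ε c} = {criticalSpeed f ε} := by
  obtain ⟨c, y, h⟩ := exists_isFirstOrderSolution hε hH hB
  have e : {c : ℝ | IsAdmissibleSpeed f ε c} = {c} := by
    refine eq_singleton_iff_unique_mem.2 ⟨⟨y, h⟩, fun c' ⟨y', h'⟩ => ?_⟩
    exact le_antisymm (h.speed_le hε hB h') (h'.speed_le hε hB h)
  rw [criticalSpeed, e, csInf_singleton]

theorem exists_criticalSolution (hε : 0 < ε) (hH : HypH f) (hB : IsTypeB f α) :
    ∃ y, IsFirstOrderSolution f ε (criticalSpeed f ε) y := by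
  have : criticalSpeed f ε ∈ {c : ℝ | IsAdmissibleSpeed f ε c} := by
    rw [setOf_isAdmissibleSpeed_eq hε hH hB]; rfl
  exact this
end

/-! ### Construction of fronts -/

/-- An autonomous equation `v' = G(v)` with `G > 0` on `(a, b)`, linearly controlled at `a` and `b`,
has a global solution through every point of `(a, b)`, and it connects `a` to `b`. -/
theorem exists_connection {G : ℝ → ℝ} {a b C v₀ : ℝ} (z₀ : ℝ) (hC : 0 < C)
    (hG : ContinuousOn G (Ioo a b)) (hpos : ∀ v ∈ Ioo a b, 0 < G v)
    (ha : ∀ v ∈ Ioo a b, G v ≤ C * (v - a)) (hb : ∀ v ∈ Ioo a b, G v ≤ C * (b - v))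
    (hv₀ : v₀ ∈ Ioo a b) :
    ∃ v : ℝ → ℝ, (∀ z, v z ∈ Ioo a b) ∧ (∀ z, HasDerivAt v (G (v z)) z) ∧ v z₀ = v₀ ∧
      Tendsto v atBot (𝓝 a) ∧ Tendsto v atTop (𝓝 b) := by
  have hab : a < b := hv₀.1.trans hv₀.2
  -- `T v` is the time at which level `v` is reached; the solution is its inverse. Linear control of
  -- `G` makes `T` diverge logarithmically at both ends, so the inverse lives on all of `ℝ`.
  set T : ℝ → ℝ := fun v => z₀ + ∫ s in v₀..v, (G s)⁻¹ with hT
  have hGi : ContinuousOn (fun s => (G s)⁻¹) (Ioo a b) := hG.inv₀ fun v hv => (hpos v hv).ne'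
  have hTd : ∀ v ∈ Ioo a b, HasDerivAt T (G v)⁻¹ v := by
    intro v hv
    refine (intervalIntegral.integral_hasDerivAt_right ?_ ?_ ?_).const_add z₀
    · refine (hGi.mono fun s hs => ?_).intervalIntegrable
      exact ordConnected_Ioo.uIcc_subset hv₀ hv hs
    · exact hGi.stronglyMeasurableAtFilter isOpen_Ioo v hv
    · exact hGi.continuousAt (isOpen_Ioo.mem_nhds hv)
  have hTc : ContinuousOn T (Ioo a b) := fun v hv => (hTd v hv).continuousAt.continuousWithinAt
  have hT0 : T v₀ = z₀ := by simp [hT]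
  have hTm : StrictMonoOn T (Ioo a b) := by
    refine strictMonoOn_of_deriv_pos (convex_Ioo a b) hTc fun v hv => ?_
    rw [interior_Ioo] at hv
    rw [(hTd v hv).deriv]
    exact inv_pos.2 (hpos v hv)
  have hup : ∀ z, ∃ v ∈ Ioo a b, z ≤ T v := by
    intro z
    have hm : MonotoneOn (fun v => T v + C⁻¹ * Real.log (b - v)) (Ioo a b) := by
      have hd : ∀ v ∈ Ioo a b, HasDerivAt (fun v => T v + C⁻¹ * Real.log (b - v))
          ((G v)⁻¹ + C⁻¹ * (-1 / (b - v))) v := fun v hv =>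
        (hTd v hv).fun_add ((((hasDerivAt_id v).const_sub b).log
          (sub_pos.2 hv.2).ne').const_mul C⁻¹)
      refine monotoneOn_of_hasDerivWithinAt_nonneg (convex_Ioo a b)
        (fun v hv => (hd v hv).continuousAt.continuousWithinAt)
        (fun v hv => (hd v (interior_subset hv)).hasDerivWithinAt) fun v hv => ?_
      have hv := interior_subset hv
      have h1 := inv_anti₀ (hpos v hv) (hb v hv)
      rw [mul_inv] at h1
      have : C⁻¹ * (-1 / (b - v)) = -(C⁻¹ * (b - v)⁻¹) := by ring
      linarith
    -- Shrinking `b - v` by this factor gains at least `|z - z₀|` in `T`.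
    set e := Real.exp (-(C * |z - z₀|)) with he
    have he1 : e ≤ 1 := Real.exp_le_one_iff.2 (by have := abs_nonneg (z - z₀); nlinarith)
    have he0 : 0 < e := Real.exp_pos _
    have hbv : 0 < b - v₀ := sub_pos.2 hv₀.2
    have hle : v₀ ≤ b - (b - v₀) * e := by nlinarith
    have hv : b - (b - v₀) * e ∈ Ioo a b := ⟨hv₀.1.trans_le hle, by nlinarith⟩
    refine ⟨_, hv, ?_⟩
    have := hm hv₀ hv hle
    simp only [hT0, sub_sub_cancel] at this
    rw [Real.log_mul hbv.ne' he0.ne', he, Real.log_exp] at this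
    have e2 : C⁻¹ * (Real.log (b - v₀) + -(C * |z - z₀|)) =
      C⁻¹ * Real.log (b - v₀) - |z - z₀| := by
      field_simp
      ring
    rw [e2] at this
    linarith [le_abs_self (z - z₀)]
  have hdown : ∀ z, ∃ v ∈ Ioo a b, T v ≤ z := by
    intro z
    have hm : MonotoneOn (fun v => T v - C⁻¹ * Real.log (v - a)) (Ioo a b) := by
      have hd : ∀ v ∈ Ioo a b, HasDerivAt (fun v => T v - C⁻¹ * Real.log (v - a))
          ((G v)⁻¹ - C⁻¹ * (1 / (v - a))) v := fun v hv =>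
        (hTd v hv).fun_sub ((((hasDerivAt_id v).sub_const a).log
          (sub_pos.2 hv.1).ne').const_mul C⁻¹)
      refine monotoneOn_of_hasDerivWithinAt_nonneg (convex_Ioo a b)
        (fun v hv => (hd v hv).continuousAt.continuousWithinAt)
        (fun v hv => (hd v (interior_subset hv)).hasDerivWithinAt) fun v hv => ?_
      have hv := interior_subset hv
      have h1 := inv_anti₀ (hpos v hv) (ha v hv)
      rw [mul_inv] at h1
      rw [one_div]
      linarith
    set e := Real.exp (-(C * |z - z₀|)) with he
    have he1 : e ≤ 1 := Real.exp_le_one_iff.2 (by have := abs_nonneg (z - z₀); nlinarith)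
    have he0 : 0 < e := Real.exp_pos _
    have hbv : 0 < v₀ - a := sub_pos.2 hv₀.1
    have hle : a + (v₀ - a) * e ≤ v₀ := by nlinarith
    have hv : a + (v₀ - a) * e ∈ Ioo a b := ⟨by nlinarith, hle.trans_lt hv₀.2⟩
    refine ⟨_, hv, ?_⟩
    have := hm hv hv₀ hle
    simp only [hT0, add_sub_cancel_left] at this
    rw [Real.log_mul hbv.ne' he0.ne', he, Real.log_exp] at this
    have e2 : C⁻¹ * (Real.log (v₀ - a) + -(C * |z - z₀|)) =
      C⁻¹ * Real.log (v₀ - a) - |z - z₀| := by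
      field_simp
      ring
    rw [e2] at this
    linarith [neg_abs_le (z - z₀)]
  have hsurj : ∀ z, ∃ v, v ∈ Ioo a b ∧ T v = z := by
    intro z
    obtain ⟨v₁, hv₁, h1⟩ := hdown z
    obtain ⟨v₂, hv₂, h2⟩ := hup z
    obtain ⟨v, hv, hvz⟩ := (isPreconnected_Ioo (a := a) (b := b)).intermediate_value hv₁ hv₂ hTc
      ⟨h1, h2⟩
    exact ⟨v, hv, hvz⟩
  choose V hV hTV using hsurj
  have hVT : ∀ v ∈ Ioo a b, V (T v) = v := fun v hv => hTm.injOn (hV _) hv (hTV _)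
  have hVm : Monotone V := fun z w hzw => by
    by_contra! h
    have := hTm (hV w) (hV z) h
    rw [hTV, hTV] at this
    linarith
  have hrange : range V = Ioo a b := by
    ext v
    exact ⟨fun ⟨z, hz⟩ => hz ▸ hV z, fun hv => ⟨T v, hVT v hv⟩⟩
  have hVc : ∀ z, ContinuousAt V z := fun z => by
    refine continuousAt_of_monotoneOn_of_image_mem_nhds (hVm.monotoneOn univ) univ_mem ?_
    rw [image_univ, hrange]
    exact isOpen_Ioo.mem_nhds (hV z)
  refine ⟨V, hV, fun z => ?_, ?_, ?_, ?_⟩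
  · have := HasDerivAt.of_local_left_inverse (hVc z) (hTd _ (hV z)) (inv_pos.2 (hpos _ (hV z))).ne'
      (Eventually.of_forall hTV)
    rwa [inv_inv] at this
  · rw [← hT0, hVT v₀ hv₀]
  · exact tendsto_atBot_isGLB hVm (hrange ▸ isGLB_Ioo hab)
  · exact tendsto_atTop_isLUB hVm (hrange ▸ isLUB_Ioo hab)

section
variable {f y : ℝ → ℝ} {α ε c : ℝ}

/-- This square-root behaviour turns a quadratic bound on `y` at `v = 1` into a linear bound on the
slope. -/
theorem frontSlope_sq_le (hε : 0 < ε) {y : ℝ} (hy : 0 ≤ y) :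
    frontSlope ε y ^ 2 ≤ 2 * y / ε := by
  rw [frontSlope_sq hε hy, div_pow, ← sub_nonneg]
  have : 2 * y / ε - (1 - ε ^ 2 / (ε + y) ^ 2) =
      y * (2 * (ε + y) ^ 2 - ε * (2 * ε + y)) / (ε * (ε + y) ^ 2) := by
    field_simp
    ring
  rw [this]
  have : 0 ≤ 2 * (ε + y) ^ 2 - ε * (2 * ε + y) := by nlinarith [mul_nonneg hε.le hy]
  positivity

/-- At `0` the momentum grows at rate at most `c`. At `1`, `y' ≥ -k (1 - v)` integrates to `y ≤ k (1
- v)² / 2`. The constant is the sum of the two resulting ones. -/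
theorem IsFirstOrderSolution.exists_frontSlope_le (hε : 0 < ε) (hH : HypH f) (hB : IsTypeB f α)
    (h : IsFirstOrderSolution f ε c y) :
    ∃ C : ℝ, 0 < C ∧ ∀ v ∈ Ioo (0 : ℝ) 1,
      frontSlope ε (y v) ≤ C * (v - 0) ∧ frontSlope ε (y v) ≤ C * (1 - v) := by
  have hc := h.speed_pos hε hB
  have hf0 := hH.nonneg hB
  obtain ⟨k, hk, hkf⟩ := hH.linear_control
  have h1 : AntitoneOn (fun v => √(y v * (2 * ε + y v)) - c * v) (Icc 0 1) := by
    refine antitoneOn_of_hasDerivWithinAt_nonpos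
      (f' := fun v => c - f v / frontSlope ε (y v) - c * 1) (convex_Icc 0 1) ?_ ?_ ?_
    · have := h.continuousOn
      fun_prop
    · intro v hv
      rw [interior_Icc] at hv
      exact ((h.hasDerivAt_momentum hε hv).fun_sub
        ((hasDerivAt_id v).const_mul c)).hasDerivWithinAt
    · intro v hv
      have := div_nonneg (hf0 v (interior_subset hv))
        (frontSlope_nonneg hε (h.nonneg v (interior_subset hv)))
      linarith
  have h2 : MonotoneOn (fun v => y v - k / 2 * (1 - v) ^ 2) (Icc 0 1) := by
    have hd : ∀ v ∈ Icc (0 : ℝ) 1, HasDerivWithinAt (fun v => y v - k / 2 * (1 - v) ^ 2)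
        (c * frontSlope ε (y v) - f v + k * (1 - v)) (Icc 0 1) v := fun v hv => by
      have := (h.hasDerivWithinAt v hv).fun_sub
        ((((hasDerivWithinAt_id v (Icc 0 1)).const_sub 1).fun_pow 2).const_mul (k / 2))
      refine this.congr_deriv ?_
      simp only [id, Nat.cast_ofNat, Nat.reduceSub, pow_one]
      ring
    refine monotoneOn_of_hasDerivWithinAt_nonneg (convex_Icc 0 1)
      (fun v hv => (hd v hv).continuousWithinAt)
      (fun v hv => (hd v (interior_subset hv)).mono interior_subset) fun v hv => ?_
    have hv := interior_subset hv
    have := (le_abs_self _).trans (hkf v hv).2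
    have := mul_nonneg hc.le (frontSlope_nonneg hε (h.nonneg v hv))
    linarith
  refine ⟨c / ε + √(k / ε), by positivity, fun v hv => ?_⟩
  have hv' : v ∈ Icc (0 : ℝ) 1 := ⟨hv.1.le, hv.2.le⟩
  have hy := h.nonneg v hv'
  have hv1 : 0 ≤ 1 - v := by linarith [hv.2]
  constructor
  · have := h1 ⟨le_rfl, zero_le_one⟩ hv' hv'.1
    simp only [h.map_zero, zero_mul, Real.sqrt_zero, mul_zero, sub_zero] at this
    have h3 : frontSlope ε (y v) ≤ c * v / ε := by
      unfold frontSlope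
      calc _ ≤ c * v / (ε + y v) := by gcongr; linarith
        _ ≤ c * v / ε := by
          have := mul_nonneg hc.le hv'.1
          gcongr; linarith
    have h4 : c * v / ε = c / ε * v := by ring
    nlinarith [mul_nonneg (Real.sqrt_nonneg (k / ε)) hv'.1]
  · have := h2 hv' ⟨zero_le_one, le_rfl⟩ hv'.2
    simp only [h.map_one, sub_self] at this
    have h3 : frontSlope ε (y v) ≤ √(k / ε) * (1 - v) := by
      refine le_of_sq_le_sq ?_ (by positivity)
      rw [mul_pow, Real.sq_sqrt (by positivity)]
      refine (frontSlope_sq_le hε hy).trans ?_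
      rw [div_mul_eq_mul_div]
      exact div_le_div_of_nonneg_right (by linarith) hε.le
    have : 0 ≤ c / ε * (1 - v) := by positivity
    linarith

/-- A first-order solution produces a front through any prescribed level. -/
theorem IsFirstOrderSolution.exists_isFront (hε : 0 < ε) (hH : HypH f) (hB : IsTypeB f α)
    (h : IsFirstOrderSolution f ε c y) {v₀ : ℝ} (hv₀ : v₀ ∈ Ioo (0 : ℝ) 1) :
    ∃ v : ℝ → ℝ, IsFront f ε c v ∧ v 0 = v₀ ∧ (∀ z, v z ∈ Ioo (0 : ℝ) 1) ∧
      ∀ z, HasDerivAt v (frontSlope ε (y (v z))) z := by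
  obtain ⟨C, hC, hCb⟩ := h.exists_frontSlope_le hε hH hB
  obtain ⟨v, hv, hd, h0, hbot, htop⟩ := exists_connection (G := fun v => frontSlope ε (y v)) 0 hC
    ((continuousOn_frontSlope hε).comp (h.continuousOn.mono Ioo_subset_Icc_self)
      fun v hv => (h.pos v hv).le)
    (fun v hv => frontSlope_pos hε (h.pos v hv)) (fun v hv => (hCb v hv).1)
    (fun v hv => (hCb v hv).2) hv₀
  have hdv : ∀ z, deriv v z = frontSlope ε (y (v z)) := fun z => (hd z).deriv
  refine ⟨v, ⟨?_, fun z => (hd z).differentiableAt, fun z => ?_, fun z => ?_, hbot, htop⟩, h0, hv,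
    hd⟩
  · refine monotone_of_deriv_nonneg (fun z => (hd z).differentiableAt) fun z => ?_
    rw [hdv]
    exact frontSlope_nonneg hε (h.pos _ (hv z)).le
  · rw [hdv, abs_of_nonneg (frontSlope_nonneg hε (h.pos _ (hv z)).le)]
    exact frontSlope_lt_one hε (h.pos _ (hv z)).le
  · have e : (fun s => ε * (deriv v s / √(1 - deriv v s ^ 2))) =
        fun s => √(y (v s) * (2 * ε + y (v s))) := by
      funext s
      rw [hdv, momentum_frontSlope hε (h.pos _ (hv s)).le]
    rw [e, hdv]
    refine ((h.hasDerivAt_momentum hε (hv z)).comp z (hd z)).congr_deriv ?_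
    have := (frontSlope_pos hε (h.pos _ (hv z))).ne'
    field_simp
end

/-! ### Uniqueness of the normalized front -/

/-- Clamping yields a globally Lipschitz field, as `f` is arbitrary outside `[0, 1]`. The lower
level `l` is `0` in the uniqueness proofs and `vp` in the limit equation. -/
theorem lipschitz_clamp {f : ℝ → ℝ} {K : ℝ} (hK : 0 ≤ K)
    (hf : ∀ x ∈ Icc (0 : ℝ) 1, ∀ y ∈ Icc (0 : ℝ) 1, |f x - f y| ≤ K * |x - y|) {l : ℝ}
    (hl : l ∈ Icc (0 : ℝ) 1) : LipschitzWith ⟨K, hK⟩ fun x => f (max l (min x 1)) := by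
  refine LipschitzWith.of_dist_le_mul fun x y => ?_
  have hm : ∀ x, max l (min x 1) ∈ Icc (0 : ℝ) 1 := fun x =>
    ⟨hl.1.trans (le_max_left _ _), max_le hl.2 (min_le_right _ _)⟩
  rw [Real.dist_eq, Real.dist_eq]
  refine (hf _ (hm x) _ (hm y)).trans (mul_le_mul_of_nonneg_left ?_ hK)
  rw [max_comm l, max_comm l]
  refine (abs_max_sub_max_le_abs _ _ l).trans ?_
  have := abs_min_sub_min_le_max x 1 y 1
  simpa using this

/-- `HypH`, type B and `HypFOn` make `f` Lipschitz on the whole unit interval. -/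
theorem exists_abs_sub_le {f : ℝ → ℝ} {α : ℝ} (hB : IsTypeB f α) (hF : HypFOn f α 1) :
    ∃ K : ℝ, 0 < K ∧ ∀ x ∈ Icc (0 : ℝ) 1, ∀ y ∈ Icc (0 : ℝ) 1, |f x - f y| ≤ K * |x - y| := by
  obtain ⟨K, hK, h⟩ := hF.locallyLipschitz.exists_abs_sub_le isCompact_Icc
  have hα := hB.threshold_mem
  have hp : ∀ x ∈ Icc (0 : ℝ) 1, f x = f (max x α) := fun x hx => by
    rcases le_total x α with h | h
    · rw [max_eq_right h, hB.eq_zero x ⟨hx.1, h⟩, hB.eq_zero α ⟨hα.1.le, le_rfl⟩]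
    · rw [max_eq_left h]
  have hm : ∀ x ∈ Icc (0 : ℝ) 1, max x α ∈ Icc α 1 := fun x hx =>
    ⟨le_max_right _ _, max_le hx.2 hα.2.le⟩
  refine ⟨K, hK, fun x hx y hy => ?_⟩
  rw [hp x hx, hp y hy]
  exact (h _ (hm x hx) _ (hm y hy)).trans
    (mul_le_mul_of_nonneg_left (abs_max_sub_max_le_abs x y α) hK.le)

section
variable {f v w : ℝ → ℝ} {α ε c : ℝ}

/-- As a function of the momentum the slope is Lipschitz even at `0`, unlike `frontSlope` in `y`;
hence uniqueness of fronts is argued in momentum variables. -/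
theorem lipschitz_div_sqrt (hε : 0 < ε) :
    LipschitzWith (1 / ε).toNNReal fun r : ℝ => r / √(ε ^ 2 + r ^ 2) := by
  have hd : ∀ r : ℝ, HasDerivAt (fun r : ℝ => r / √(ε ^ 2 + r ^ 2))
      (ε ^ 2 / √(ε ^ 2 + r ^ 2) ^ 3) r := by
    intro r
    have hs : √(ε ^ 2 + r ^ 2) ^ 2 = ε ^ 2 + r ^ 2 := Real.sq_sqrt (by positivity)
    have hs0 : √(ε ^ 2 + r ^ 2) ≠ 0 := by positivity
    have h1 := (((hasDerivAt_id r).fun_pow 2).const_add (ε ^ 2)).sqrt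
      (by simp only [id]; positivity)
    refine ((hasDerivAt_id r).fun_div h1 hs0).congr_deriv ?_
    simp only [id, Nat.cast_ofNat, Nat.reduceSub, pow_one]
    field_simp
    rw [hs]
    ring
  refine lipschitzWith_of_nnnorm_deriv_le (fun r => (hd r).differentiableAt) fun r => ?_
  rw [← NNReal.coe_le_coe, coe_nnnorm, Real.coe_toNNReal _ (by positivity), (hd r).deriv,
    Real.norm_of_nonneg (by positivity)]
  have : ε ≤ √(ε ^ 2 + r ^ 2) := Real.le_sqrt_of_sq_le (by nlinarith [sq_nonneg r])
  rw [div_le_div_iff₀ (by positivity) hε, one_mul, ← pow_succ]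
  gcongr

theorem div_sqrt_le_div_sqrt (hε : 0 < ε) {r s : ℝ} (hr : 0 ≤ r) (hrs : r ≤ s) :
    r / √(ε ^ 2 + r ^ 2) ≤ s / √(ε ^ 2 + s ^ 2) := by
  rw [← frontSlope_sqrt_sub hε hr, ← frontSlope_sqrt_sub hε (hr.trans hrs)]
  refine frontSlope_le_frontSlope hε ?_ (by gcongr)
  exact sub_nonneg.2 (Real.le_sqrt_of_sq_le (by nlinarith [sq_nonneg r]))

theorem IsFront.mem_Icc (h : IsFront f ε c v) (z : ℝ) : v z ∈ Icc (0 : ℝ) 1 :=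
  ⟨h.monotone.le_of_tendsto h.tendsto_atBot z, h.monotone.ge_of_tendsto h.tendsto_atTop z⟩

theorem IsFront.deriv_eq (hε : 0 < ε) (h : IsFront f ε c v) (z : ℝ) :
    deriv v z = ε * (deriv v z / √(1 - deriv v z ^ 2)) /
      √(ε ^ 2 + (ε * (deriv v z / √(1 - deriv v z ^ 2))) ^ 2) := by
  have hp : 0 < 1 - deriv v z ^ 2 := by
    have := (sq_lt_one_iff_abs_lt_one _).2 (h.slope_lt_one z)
    linarith
  set p := deriv v z
  have hs : √(1 - p ^ 2) ^ 2 = 1 - p ^ 2 := Real.sq_sqrt hp.le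
  have hs0 : 0 < √(1 - p ^ 2) := Real.sqrt_pos.2 hp
  have e : ε ^ 2 + (ε * (p / √(1 - p ^ 2))) ^ 2 = (ε / √(1 - p ^ 2)) ^ 2 := by
    field_simp
    rw [hs]
    ring
  rw [e, Real.sqrt_sq (by positivity)]
  field_simp

theorem IsFront.momentum_nonneg (hε : 0 < ε) (h : IsFront f ε c v) (z : ℝ) :
    0 ≤ ε * (deriv v z / √(1 - deriv v z ^ 2)) := by
  have : 0 ≤ deriv v z := h.monotone.deriv_nonneg
  positivity

/-- On the part where `f(v) = 0` the momentum of a front equals `c v`. -/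
theorem IsFront.momentum_zero (hε : 0 < ε) (hc : 0 < c) (hB : IsTypeB f α)
    (h : IsFront f ε c v) (h0 : v 0 = α) :
    ε * (deriv v 0 / √(1 - deriv v 0 ^ 2)) = c * α := by
  set R : ℝ → ℝ := fun s => ε * (deriv v s / √(1 - deriv v s ^ 2)) with hR
  have hd : ∀ z, HasDerivAt (fun s => R s - c * v s) (c * deriv v z - f (v z) - c * deriv v z) z :=
    fun z => (h.ode z).fun_sub ((h.differentiable z).hasDerivAt.const_mul c)
  have hle : ∀ z ≤ 0, v z ≤ α := fun z hz => h0 ▸ h.monotone hz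
  have hd0 : ∀ z ∈ interior (Iic (0 : ℝ)),
      HasDerivWithinAt (fun s => R s - c * v s) 0 (interior (Iic 0)) z := fun z hz => by
    have := hd z
    rw [hB.eq_zero (v z) ⟨(h.mem_Icc z).1, hle z (mem_Iic.1 (interior_subset hz))⟩] at this
    simpa using this.hasDerivWithinAt
  have hcont : ContinuousOn (fun s => R s - c * v s) (Iic 0) := fun z _ =>
    (hd z).continuousAt.continuousWithinAt
  have m1 := monotoneOn_of_hasDerivWithinAt_nonneg (convex_Iic 0) hcont hd0 fun _ _ => le_rfl
  have m2 := antitoneOn_of_hasDerivWithinAt_nonpos (convex_Iic 0) hcont hd0 fun _ _ => le_rfl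
  have hconst : ∀ z ≤ 0, R z - c * v z = R 0 - c * v 0 := fun z hz =>
    le_antisymm (m1 hz self_mem_Iic hz) (m2 hz self_mem_Iic hz)
  rw [h0] at hconst
  change R 0 = c * α
  -- If the momentum stayed above `δ` far to the left, `v'` would be at least `q > 0` there,
  -- impossible for a bounded `v`.
  have hexists : ∀ δ > 0, ∃ z ≤ 0, c * v z < δ ∧ R z < δ := by
    intro δ hδ
    have hv0 : Tendsto (fun z => c * v z) atBot (𝓝 0) := by
      simpa using h.tendsto_atBot.const_mul c
    obtain ⟨z₁, hz₁⟩ := (hv0.eventually (gt_mem_nhds hδ)).exists_forall_of_atBot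
    by_contra! hcon
    set q := δ / √(ε ^ 2 + δ ^ 2) with hq
    have hq0 : 0 < q := by positivity
    have hz₂ : ∀ z ≤ min z₁ 0, q ≤ deriv v z := by
      intro z hz
      have hRz := hcon z (hz.trans (min_le_right _ _)) (hz₁ z (hz.trans (min_le_left _ _)))
      have e : deriv v z = R z / √(ε ^ 2 + R z ^ 2) := h.deriv_eq hε z
      rw [e]
      exact div_sqrt_le_div_sqrt hε hδ.le hRz
    have hm : MonotoneOn (fun z => v z - q * z) (Iic (min z₁ 0)) := by
      have hd : ∀ z, HasDerivAt (fun z => v z - q * z) (deriv v z - q * 1) z := fun z =>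
        (h.differentiable z).hasDerivAt.fun_sub ((hasDerivAt_id z).const_mul q)
      refine monotoneOn_of_hasDerivWithinAt_nonneg (convex_Iic _)
        (fun z _ => (hd z).continuousAt.continuousWithinAt)
        (fun z _ => (hd z).hasDerivWithinAt) fun z hz => ?_
      linarith [hz₂ z (mem_Iic.1 (interior_subset hz))]
    have hq2 : 0 ≤ 2 / q := by positivity
    have h2 : min z₁ 0 - 2 / q ∈ Iic (min z₁ 0) := sub_le_self _ hq2
    have := hm h2 self_mem_Iic h2
    have e : q * (min z₁ 0 - 2 / q) = q * min z₁ 0 - 2 := by field_simp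
    simp only [e] at this
    linarith [(h.mem_Icc (min z₁ 0)).2, (h.mem_Icc (min z₁ 0 - 2 / q)).1]
  by_contra hne
  -- Two numbers in `[0, δ)` differ by less than `δ`, yet `R - c v` is constant on `(-∞, 0]` with
  -- absolute value `δ`.
  obtain ⟨z, hz, hz1, hz2⟩ := hexists |R 0 - c * α| (abs_pos.2 (sub_ne_zero.2 hne))
  have e := hconst z hz
  have hR0 : 0 ≤ R z := h.momentum_nonneg hε z
  have hv0 : 0 ≤ c * v z := mul_nonneg hc.le (h.mem_Icc z).1
  rw [← e] at hz1 hz2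
  exact absurd (abs_sub_lt_of_nonneg_of_lt hR0 hz2 hv0 hz1) (lt_irrefl _)

/-- The pair of `v` and momentum solves a globally Lipschitz autonomous system, and
`IsFront.momentum_zero` fixes both components at `z = 0`. -/
theorem IsFront.eq_of_map_zero {K : ℝ} (hε : 0 < ε) (hc : 0 < c) (hB : IsTypeB f α) (hK : 0 ≤ K)
    (hf : ∀ x ∈ Icc (0 : ℝ) 1, ∀ y ∈ Icc (0 : ℝ) 1, |f x - f y| ≤ K * |x - y|)
    (hv : IsFront f ε c v) (hw : IsFront f ε c w) (hv0 : v 0 = α) (hw0 : w 0 = α) : v = w := by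
  set φ : ℝ → ℝ := fun r => r / √(ε ^ 2 + r ^ 2) with hφ
  set F : ℝ × ℝ → ℝ × ℝ := fun x => (φ x.2, c * φ x.2 - f (max 0 (min x.1 1))) with hF
  have hφL : LipschitzWith _ φ := lipschitz_div_sqrt hε
  obtain ⟨L, hL⟩ : ∃ L, LipschitzWith L F := by
    have h1 := hφL.comp (LipschitzWith.prod_snd (α := ℝ) (β := ℝ))
    have h2 := (lipschitz_clamp hK hf ⟨le_rfl, zero_le_one⟩).comp
      (LipschitzWith.prod_fst (α := ℝ) (β := ℝ))
    exact ⟨_, h1.prodMk (((lipschitzWith_smul c).comp h1).sub h2)⟩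
  have key : ∀ u : ℝ → ℝ, IsFront f ε c u → ∀ z,
      HasDerivAt (fun s => (u s, ε * (deriv u s / √(1 - deriv u s ^ 2))))
        (F (u z, ε * (deriv u z / √(1 - deriv u z ^ 2)))) z := by
    intro u hu z
    have e := hu.deriv_eq hε z
    have h1 := (hu.differentiable z).hasDerivAt
    have h2 := hu.ode z
    have hm : max 0 (min (u z) 1) = u z := by
      rw [min_eq_left (hu.mem_Icc z).2, max_eq_right (hu.mem_Icc z).1]
    have : F (u z, ε * (deriv u z / √(1 - deriv u z ^ 2))) =
        (deriv u z, c * deriv u z - f (u z)) := by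
      simp only [hF, hφ, hm, ← e]
    rw [this]
    exact h1.prodMk h2
  have := ODE_solution_unique_univ (v := fun _ => F) (s := fun _ => univ) (K := L) (t₀ := 0)
    (fun _ => hL.lipschitzOnWith) (fun t => ⟨key v hv t, trivial⟩)
    (fun t => ⟨key w hw t, trivial⟩) (by
      simp only [Prod.mk.injEq]
      exact ⟨by rw [hv0, hw0], by rw [hv.momentum_zero hε hc hB hv0,
        hw.momentum_zero hε hc hB hw0]⟩)
  funext z
  exact congrArg Prod.fst (congrFun this z)
end

section
variable {f y : ℝ → ℝ} {α ε c : ℝ}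

theorem existsUnique_isCriticalFront (hε : 0 < ε) (hH : HypH f) (hB : IsTypeB f α)
    (hF : HypFOn f α 1) : ∃! v : ℝ → ℝ, IsCriticalFront f α ε v := by
  obtain ⟨y, hy⟩ := exists_criticalSolution hε hH hB
  obtain ⟨v, hv, hv0, -⟩ := hy.exists_isFront hε hH hB hB.threshold_mem
  obtain ⟨K, hK, hKf⟩ := exists_abs_sub_le hB hF
  exact ⟨v, ⟨hv, hv0⟩, fun w hw =>
    hw.1.eq_of_map_zero hε (hy.speed_pos hε hB) hB hK.le hKf hv hw.2 hv0⟩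

/-- The critical front solves the first-order equation `v' = frontSlope ε (y(v))`. -/
theorem IsCriticalFront.exists_hasDerivAt (hε : 0 < ε) (hH : HypH f) (hB : IsTypeB f α)
    (hF : HypFOn f α 1) {v : ℝ → ℝ} (hv : IsCriticalFront f α ε v) :
    ∃ y, IsFirstOrderSolution f ε (criticalSpeed f ε) y ∧ (∀ z, v z ∈ Ioo (0 : ℝ) 1) ∧
      ∀ z, HasDerivAt v (frontSlope ε (y (v z))) z := by
  obtain ⟨y, hy⟩ := exists_criticalSolution hε hH hB
  obtain ⟨w, hw, hw0, hw1, hw2⟩ := hy.exists_isFront hε hH hB hB.threshold_mem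
  rw [(existsUnique_isCriticalFront hε hH hB hF).unique hv ⟨hw, hw0⟩]
  exact ⟨y, hy, hw1, hw2⟩

/-! ### Shape of `f` and the steepest chord of its primitive -/

/-- If `f x ≥ f w` with `x < w ≤ m`, the maximum over `[p, w]` is attained before `w`, which gives a
local maximum other than `m`. -/
theorem strictMonoOn_of_unique_localMax {p q m : ℝ} (hc : ContinuousOn f (Icc p q))
    (hm : m ∈ Ioo p q) (h : ∀ x ∈ Icc p q, IsLocalMaxOn f (Icc p q) x → x = m) :
    StrictMonoOn f (Icc p m) := by
  intro x hx w hw hxw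
  by_contra! hle
  obtain ⟨t, ht, htmax⟩ := isCompact_Icc.exists_isMaxOn (nonempty_Icc.2 hw.1)
    (hc.mono (Icc_subset_Icc_right (hw.2.trans hm.2.le)))
  obtain ⟨t, ht, htw, htmax⟩ : ∃ t ∈ Icc p w, t < w ∧ IsMaxOn f (Icc p w) t := by
    rcases ht.2.lt_or_eq with h' | rfl
    · exact ⟨t, ht, h', htmax⟩
    · exact ⟨x, ⟨hx.1, hxw.le⟩, hxw, fun s hs => (htmax hs).trans hle⟩
  have := h t ⟨ht.1, ht.2.trans (hw.2.trans hm.2.le)⟩ (by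
    filter_upwards [self_mem_nhdsWithin, nhdsWithin_le_nhds (Iio_mem_nhds htw)] with s hs hs'
    exact htmax ⟨hs.1, (mem_Iio.1 hs').le⟩)
  linarith [hw.2]

theorem strictAntiOn_of_unique_localMax {p q m : ℝ} (hc : ContinuousOn f (Icc p q))
    (hm : m ∈ Ioo p q) (h : ∀ x ∈ Icc p q, IsLocalMaxOn f (Icc p q) x → x = m) :
    StrictAntiOn f (Icc m q) := by
  intro w hw x hx hwx
  by_contra! hle
  obtain ⟨t, ht, htmax⟩ := isCompact_Icc.exists_isMaxOn (nonempty_Icc.2 hw.2)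
    (hc.mono (Icc_subset_Icc_left (hm.1.le.trans hw.1)))
  obtain ⟨t, ht, htw, htmax⟩ : ∃ t ∈ Icc w q, w < t ∧ IsMaxOn f (Icc w q) t := by
    rcases ht.1.lt_or_eq with h' | rfl
    · exact ⟨t, ht, h', htmax⟩
    · exact ⟨x, ⟨hwx.le, hx.2⟩, hwx, fun s hs => (htmax hs).trans hle⟩
  have := h t ⟨hm.1.le.trans (hw.1.trans ht.1), ht.2⟩ (by
    filter_upwards [self_mem_nhdsWithin, nhdsWithin_le_nhds (Ioi_mem_nhds htw)] with s hs hs'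
    exact htmax ⟨(mem_Ioi.1 hs').le, hs.2⟩)
  linarith [hw.1]

theorem hasDerivWithinAt_reactionPrimitive (hc : ContinuousOn f (Icc 0 1)) :
    ∀ v ∈ Icc (0 : ℝ) 1, HasDerivWithinAt (reactionPrimitive f) (f v) (Icc 0 1) v := by
  have hi : ∀ a ∈ Icc (0 : ℝ) 1, ∀ b ∈ Icc (0 : ℝ) 1,
      IntervalIntegrable f MeasureTheory.volume a b := fun a ha b hb =>
    (hc.mono (ordConnected_Icc.uIcc_subset ha hb)).intervalIntegrable
  have h0 : (0 : ℝ) ∈ Icc (0 : ℝ) 1 := ⟨le_rfl, zero_le_one⟩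
  have h1 : (1 : ℝ) ∈ Icc (0 : ℝ) 1 := ⟨zero_le_one, le_rfl⟩
  intro v hv
  have := hasDerivWithinAt_of_eq_integral (y := fun v => reactionPrimitive f v -
    reactionPrimitive f 1) hc (fun t ht => by
      rw [sub_eq_iff_eq_add']
      exact (intervalIntegral.integral_add_adjacent_intervals (hi 0 h0 1 h1) (hi 1 h1 t ht)).symm)
    v hv
  exact (hasDerivWithinAt_sub_const_iff _).1 this

theorem mul_sub_le_reactionPrimitive {p u w : ℝ} (hc : ContinuousOn f (Icc 0 1)) (hu : 0 ≤ u)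
    (huw : u ≤ w) (hw : w ≤ 1) (h : ∀ s ∈ Ioo u w, p ≤ f s) :
    p * (w - u) ≤ reactionPrimitive f w - reactionPrimitive f u := by
  have hsub : Icc u w ⊆ Icc (0 : ℝ) 1 := Icc_subset_Icc hu hw
  have hd : ∀ s ∈ Icc u w, HasDerivWithinAt (fun s => reactionPrimitive f s - p * s)
      (f s - p * 1) (Icc u w) s := fun s hs =>
    ((hasDerivWithinAt_reactionPrimitive hc s (hsub hs)).mono hsub).fun_sub
      ((hasDerivWithinAt_id s _).const_mul p)
  have hm := monotoneOn_of_hasDerivWithinAt_nonneg (convex_Icc u w)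
    (fun s hs => (hd s hs).continuousWithinAt)
    (fun s hs => (hd s (interior_subset hs)).mono interior_subset) (fun s hs => by
      rw [interior_Icc] at hs
      linarith [h s hs])
  have := hm ⟨le_rfl, huw⟩ ⟨huw, le_rfl⟩ huw
  simp only at this
  linarith

theorem reactionPrimitive_le_mul_sub {p u w : ℝ} (hc : ContinuousOn f (Icc 0 1)) (hu : 0 ≤ u)
    (huw : u ≤ w) (hw : w ≤ 1) (h : ∀ s ∈ Ioo u w, f s ≤ p) :
    reactionPrimitive f w - reactionPrimitive f u ≤ p * (w - u) := by
  have hsub : Icc u w ⊆ Icc (0 : ℝ) 1 := Icc_subset_Icc hu hw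
  have hd : ∀ s ∈ Icc u w, HasDerivWithinAt (fun s => p * s - reactionPrimitive f s)
      (p * 1 - f s) (Icc u w) s := fun s hs =>
    ((hasDerivWithinAt_id s _).const_mul p).fun_sub
      ((hasDerivWithinAt_reactionPrimitive hc s (hsub hs)).mono hsub)
  have hm := monotoneOn_of_hasDerivWithinAt_nonneg (convex_Icc u w)
    (fun s hs => (hd s hs).continuousWithinAt)
    (fun s hs => (hd s (interior_subset hs)).mono interior_subset) (fun s hs => by
      rw [interior_Icc] at hs
      linarith [h s hs])
  have := hm ⟨le_rfl, huw⟩ ⟨huw, le_rfl⟩ huw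
  simp only at this
  linarith

theorem reactionPrimitive_eq_zero (hH : HypH f) (hB : IsTypeB f α) {v : ℝ} (hv : v ∈ Icc 0 α) :
    reactionPrimitive f v = 0 := by
  have hz : ∀ s ∈ Ioo 0 v, f s = 0 := fun s hs => hB.eq_zero s ⟨hs.1.le, hs.2.le.trans hv.2⟩
  have hv1 := hv.2.trans hB.threshold_mem.2.le
  have h1 := mul_sub_le_reactionPrimitive hH.continuousOn le_rfl hv.1 hv1 fun s hs => (hz s hs).ge
  have h2 := reactionPrimitive_le_mul_sub hH.continuousOn le_rfl hv.1 hv1 fun s hs => (hz s hs).le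
  have h0 : reactionPrimitive f 0 = 0 := by simp [reactionPrimitive]
  linarith

/-- The level `vp` at which the chord of the primitive from the origin is steepest. -/
structure IsTangencyLevel (f : ℝ → ℝ) (α m vp : ℝ) : Prop where
  lt_argmax : α < m
  argmax_lt : m < vp
  lt_one : vp < 1
  strictAntiOn : StrictAntiOn f (Icc m 1)
  eq_mul : reactionPrimitive f vp = vp * f vp
  isGreatest : IsGreatest {v : ℝ | v ∈ Icc (0 : ℝ) 1 ∧ reactionPrimitive f v = v * f v} vp
  speed_pos : 0 < f vp
  lt_mul : ∀ v ∈ Ioo 0 vp, reactionPrimitive f v < f vp * v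
  le_mul : ∀ v ∈ Icc (0 : ℝ) 1, reactionPrimitive f v ≤ f vp * v

/-- The function `v f(v) - F(v)` strictly decreases beyond the maximum point `m` of `f`, from a
positive value at `m` to `-F(1) < 0`. Its zero there is the tangency level. -/
theorem exists_isTangencyLevel (hH : HypH f) (hB : IsTypeB f α) (hF : HypFOn f α 1) :
    ∃ m vp, IsTangencyLevel f α m vp := by
  have hα := hB.threshold_mem
  have hc := hH.continuousOn
  have hf0 := hH.nonneg hB
  obtain ⟨m, hm, huniq⟩ := hF.unique_localMax
  have hc' : ContinuousOn f (Icc α 1) := hc.mono (Icc_subset_Icc_left hα.1.le)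
  have hmono := strictMonoOn_of_unique_localMax hc' hm fun x hx => (huniq x hx).1
  have hanti := strictAntiOn_of_unique_localMax hc' hm fun x hx => (huniq x hx).1
  have hm0 : 0 < m := hα.1.trans hm.1
  set F := reactionPrimitive f with hFdef
  have hFα : F α = 0 := reactionPrimitive_eq_zero hH hB ⟨hα.1.le, le_rfl⟩
  have hFle : ∀ v ∈ Icc α m, F v ≤ f v * (v - α) := by
    intro v hv
    have := reactionPrimitive_le_mul_sub (p := f v) hc hα.1.le hv.1 (hv.2.trans hm.2.le)
      fun s hs => (hmono ⟨hs.1.le, hs.2.le.trans hv.2⟩ hv hs.2).le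
    linarith
  set h : ℝ → ℝ := fun v => v * f v - F v with hh
  have hFc : ContinuousOn F (Icc 0 1) := fun v hv =>
    (hasDerivWithinAt_reactionPrimitive hc v hv).continuousWithinAt
  have hsub : Icc m 1 ⊆ Icc (0 : ℝ) 1 := Icc_subset_Icc_left hm0.le
  have hhc : ContinuousOn h (Icc m 1) :=
    (continuousOn_id.mul (hc.mono hsub)).sub (hFc.mono hsub)
  have hh_anti : StrictAntiOn h (Icc m 1) := by
    intro v hv w hw hvw
    have h1 := mul_sub_le_reactionPrimitive (p := f w) hc (hm0.le.trans hv.1) hvw.le hw.2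
      fun s hs => (hanti ⟨hv.1.trans hs.1.le, hs.2.le.trans hw.2⟩ hw hs.2).le
    have h2 := mul_lt_mul_of_pos_left (hanti hv hw hvw) (hm0.trans_le hv.1)
    simp only [hh]
    linarith
  have hhm : 0 < h m := by
    have h1 := hFle m ⟨hm.1.le, le_rfl⟩
    have h2 := mul_pos hα.1 (hB.pos m hm)
    simp only [hh]
    linarith
  have hF1 : 0 < F 1 := by
    have hw : (m + 1) / 2 ∈ Ioo m 1 := ⟨by linarith [hm.2], by linarith [hm.2]⟩
    have hmw : (m + 1) / 2 ∈ Icc m 1 := ⟨hw.1.le, hw.2.le⟩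
    have h1 := mul_sub_le_reactionPrimitive (p := f ((m + 1) / 2)) hc hm0.le hw.1.le hw.2.le
      fun s hs => (hanti ⟨hs.1.le, hs.2.le.trans hw.2.le⟩ hmw hs.2).le
    have h2 := mul_sub_le_reactionPrimitive (p := 0) hc (hm0.le.trans hw.1.le) hw.2.le le_rfl
      fun s hs => hf0 s ⟨hm0.le.trans (hw.1.trans hs.1).le, hs.2.le⟩
    have h3 := mul_sub_le_reactionPrimitive (p := 0) hc hα.1.le hm.1.le hm.2.le
      fun s hs => hf0 s ⟨hα.1.le.trans hs.1.le, hs.2.le.trans hm.2.le⟩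
    have h4 := mul_pos (hB.pos _ ⟨hm.1.trans hw.1, hw.2⟩) (sub_pos.2 hw.1)
    linarith
  have hh1 : h 1 < 0 := by
    simp only [hh, hH.map_one]
    linarith
  obtain ⟨vp, hvp, hvp0⟩ : (0 : ℝ) ∈ h '' Icc m 1 :=
    intermediate_value_Icc' hm.2.le hhc ⟨hh1.le, hhm.le⟩
  have hmvp : m < vp := hvp.1.lt_of_ne (by rintro rfl; linarith)
  have hvp1 : vp < 1 := hvp.2.lt_of_ne (by rintro rfl; linarith)
  have heq : F vp = vp * f vp := by simp only [hh] at hvp0; linarith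
  have hfp : 0 < f vp := hB.pos vp ⟨hm.1.trans hmvp, hvp1⟩
  have hlt_right : ∀ v ∈ Ico m vp, F v < f vp * v := by
    intro v hv
    -- The intermediate point makes the inequality strict: on `(v, w)`, `f` exceeds `f w > f vp`.
    set w := (v + vp) / 2 with hw
    have hvw : v < w := by linarith [hv.2]
    have hwp : w < vp := by linarith [hv.2]
    have hwI : w ∈ Icc m 1 := ⟨hv.1.trans hvw.le, (hwp.trans hvp1).le⟩
    have h1 := mul_sub_le_reactionPrimitive (p := f w) hc (hm0.le.trans hv.1) hvw.le hwI.2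
      fun s hs => (hanti ⟨hv.1.trans hs.1.le, hs.2.le.trans hwI.2⟩ hwI hs.2).le
    have h2 := mul_sub_le_reactionPrimitive (p := f vp) hc (hm0.le.trans hwI.1) hwp.le hvp1.le
      fun s hs => (hanti ⟨hwI.1.trans hs.1.le, (hs.2.trans hvp1).le⟩ hvp hs.2).le
    have h3 := mul_lt_mul_of_pos_right (hanti hwI hvp hwp) (sub_pos.2 hvw)
    linarith
  have hlt : ∀ v ∈ Ioo 0 vp, F v < f vp * v := by
    intro v hv
    rcases le_or_gt m v with hmv | hmv
    · exact hlt_right v ⟨hmv, hv.2⟩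
    rcases le_or_gt v α with hvα | hvα
    · rw [hFdef, reactionPrimitive_eq_zero hH hB ⟨hv.1.le, hvα⟩]
      exact mul_pos hfp hv.1
    -- If `f v ≤ f vp`, the rectangle bound `F v ≤ f v (v - α)` suffices. Otherwise `f ≥ f vp` on
    -- `[v, m]`, and the strict bound at `m` propagates back to `v`.
    · rcases le_or_gt (f v) (f vp) with hle | hgt
      · have h1 := hFle v ⟨hvα.le, hmv.le⟩
        have h2 := mul_le_mul_of_nonneg_right hle (sub_nonneg.2 hvα.le)
        have h3 := mul_pos hfp hα.1
        linarith
      · have h1 := mul_sub_le_reactionPrimitive (p := f vp) hc hv.1.le hmv.le hm.2.le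
          fun s hs => hgt.le.trans
            (hmono ⟨hvα.le, hmv.le⟩ ⟨(hvα.trans hs.1).le, hs.2.le⟩ hs.1).le
        have h2 := hlt_right m ⟨le_rfl, hmvp⟩
        linarith
  refine ⟨m, vp, hm.1, hmvp, hvp1, hanti, heq, ⟨⟨hsub hvp, heq⟩, fun v hv => ?_⟩, hfp, hlt,
    fun v hv => ?_⟩
  · by_contra! hlt'
    have := hh_anti hvp ⟨hvp.1.trans hlt'.le, hv.1.2⟩ hlt'
    have e : h v = 0 := by simp only [hh, hFdef, hv.2, sub_self]
    linarith
  · rcases hv.1.eq_or_lt with rfl | hv0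
    · simp [reactionPrimitive]
    rcases lt_or_ge v vp with hvv | hvv
    · exact (hlt v ⟨hv0, hvv⟩).le
    · have := reactionPrimitive_le_mul_sub (p := f vp) hc (hm0.le.trans hvp.1) hvv hv.2
        fun s hs => (hanti hvp ⟨hvp.1.trans hs.1.le, hs.2.le.trans hv.2⟩ hs.1).le
      linarith
end

/-! ### Limit of the critical speed -/

section
variable {f y : ℝ → ℝ} {α ε c m vp : ℝ}

/-- Integrate `y' ≤ c - f`, valid because the slope is below `1`. At `vp` this yields the lower
bound on the speed. -/
theorem IsFirstOrderSolution.le_mul_sub (hε : 0 < ε) (hH : HypH f) (hB : IsTypeB f α)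
    (h : IsFirstOrderSolution f ε c y) {v : ℝ} (hv : v ∈ Icc (0 : ℝ) 1) :
    y v ≤ c * v - reactionPrimitive f v := by
  have hc := h.speed_pos hε hB
  have hd : ∀ v ∈ Icc (0 : ℝ) 1, HasDerivWithinAt (fun v => c * v - reactionPrimitive f v - y v)
      (c * 1 - f v - (c * frontSlope ε (y v) - f v)) (Icc 0 1) v := fun v hv =>
    (((hasDerivWithinAt_id v _).const_mul c).fun_sub
      (hasDerivWithinAt_reactionPrimitive hH.continuousOn v hv)).fun_sub
        (h.hasDerivWithinAt v hv)
  have hm := monotoneOn_of_hasDerivWithinAt_nonneg (convex_Icc 0 1)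
    (fun v hv => (hd v hv).continuousWithinAt)
    (fun v hv => (hd v (interior_subset hv)).mono interior_subset) (fun v hv => by
      have := mul_le_mul_of_nonneg_left
        (frontSlope_lt_one hε (h.nonneg v (interior_subset hv))).le hc.le
      linarith)
  have := hm ⟨le_rfl, zero_le_one⟩ hv hv.1
  simp only [h.map_zero, reactionPrimitive, intervalIntegral.integral_same, mul_zero,
    sub_zero] at this
  unfold reactionPrimitive
  linarith

theorem IsFirstOrderSolution.lt_speed (hε : 0 < ε) (hH : HypH f) (hB : IsTypeB f α)
    (hvp : IsTangencyLevel f α m vp) (h : IsFirstOrderSolution f ε c y) : f vp < c := by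
  have hα := hB.threshold_mem
  have hvp0 : 0 < vp := hα.1.trans (hvp.lt_argmax.trans hvp.argmax_lt)
  have h1 := h.le_mul_sub hε hH hB (v := vp) ⟨hvp0.le, hvp.lt_one.le⟩
  have h2 := h.pos vp ⟨hvp0, hvp.lt_one⟩
  rw [hvp.eq_mul] at h1
  have h3 : 0 < (c - f vp) * vp := by linarith
  linarith [pos_of_mul_pos_left h3 hvp0.le]

/-- The subsolution `q v - F(v)` of the first-order equation. -/
theorem IsFirstOrderSolution.mul_sub_le {a b q μ : ℝ} (hε : 0 < ε) (hH : HypH f)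
    (hB : IsTypeB f α) (h : IsFirstOrderSolution f ε c y) (ha : 0 ≤ a) (hb : b ≤ 1)
    (hya : q * a - reactionPrimitive f a < y a) (hμ : 0 ≤ μ)
    (hμq : ∀ v ∈ Icc a b, μ ≤ q * v - reactionPrimitive f v) (hq : q ≤ c * frontSlope ε μ)
    {v : ℝ} (hv : v ∈ Icc a b) : q * v - reactionPrimitive f v ≤ y v := by
  have hc := h.speed_pos hε hB
  have hsub : Icc a v ⊆ Icc (0 : ℝ) 1 := Icc_subset_Icc ha (hv.2.trans hb)
  have := le_of_deriv_nonneg_of_nonneg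
    (d := fun v => y v - (q * v - reactionPrimitive f v)) hv.1
    (fun s hs => ((h.hasDerivWithinAt s (hsub hs)).mono hsub).fun_sub
      (((hasDerivWithinAt_id s _).const_mul q).fun_sub
        ((hasDerivWithinAt_reactionPrimitive hH.continuousOn s (hsub hs)).mono hsub)))
    (by linarith) (fun s hs h0 => by
      -- Above the barrier `y ≥ μ`, so `c * frontSlope ε (y s) ≥ q`, and `y` rises at least as fast
      -- as the barrier.
      have h1 : μ ≤ y s := by linarith [hμq s ⟨hs.1, hs.2.trans hv.2⟩]
      have h2 := mul_le_mul_of_nonneg_left (frontSlope_le_frontSlope hε hμ h1) hc.le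
      linarith)
  linarith

theorem IsFirstOrderSolution.mul_sub_le_apply (hε : 0 < ε) (hB : IsTypeB f α)
    (h : IsFirstOrderSolution f ε c y) {v : ℝ} (hv : v ∈ Icc 0 α) : c * v - ε ≤ y v := by
  rw [h.eq_sqrt_sub hε hB hv]
  have : c * v ≤ √(ε ^ 2 + (c * v) ^ 2) := Real.le_sqrt_of_sq_le (by nlinarith [sq_nonneg ε])
  linarith

/-- For `c ≥ f vp + δ` and small `ε`, the barrier `(f vp + δ / 2) v - F(v)` is at least `δ α / 2` on
`[α, 1]` and starts below `y` at `α`. It would force `y(1) > 0`. -/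
theorem eventually_speed_lt (hH : HypH f) (hB : IsTypeB f α) (hvp : IsTangencyLevel f α m vp)
    {δ : ℝ} (hδ : 0 < δ) :
    ∀ᶠ ε in 𝓝[>] (0 : ℝ), ∀ c y, IsFirstOrderSolution f ε c y → c < f vp + δ := by
  have hα := hB.threshold_mem
  have hμ : 0 < δ * α / 2 := by have := mul_pos hδ hα.1; linarith
  have hp := hvp.speed_pos
  have hlim := (tendsto_frontSlope hμ).const_mul (f vp + δ)
  have h1 := hlim.eventually (lt_mem_nhds (show f vp + δ / 2 < (f vp + δ) * 1 by linarith))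
  filter_upwards [h1, self_mem_nhdsWithin, nhdsWithin_le_nhds (Iio_mem_nhds hμ)]
    with ε h1 hε hε' c y h
  rw [mem_Ioi] at hε
  rw [mem_Iio] at hε'
  by_contra! hcon
  have hαα : α ∈ Icc 0 α := ⟨hα.1.le, le_rfl⟩
  have hyα := h.mul_sub_le_apply hε hB hαα
  have hcα := mul_le_mul_of_nonneg_right hcon hα.1.le
  have hμq : ∀ v ∈ Icc α 1, δ * α / 2 ≤ (f vp + δ / 2) * v - reactionPrimitive f v := by
    intro v hv
    have := hvp.le_mul v ⟨hα.1.le.trans hv.1, hv.2⟩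
    have := mul_le_mul_of_nonneg_left hv.1 hδ.le
    linarith
  have hs := mul_le_mul_of_nonneg_right hcon (frontSlope_nonneg hε hμ.le)
  have h11 : (1 : ℝ) ∈ Icc α 1 := ⟨hα.2.le, le_rfl⟩
  have := h.mul_sub_le hε hH hB hα.1.le le_rfl
    (by rw [reactionPrimitive_eq_zero hH hB hαα]; linarith) hμ.le hμq (h1.le.trans hs) h11
  rw [h.map_one] at this
  linarith [hμq 1 h11]

theorem tendsto_criticalSpeed (hH : HypH f) (hB : IsTypeB f α)
    (hvp : IsTangencyLevel f α m vp) :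
    Tendsto (fun ε => criticalSpeed f ε) (𝓝[>] 0) (𝓝 (f vp)) := by
  rw [Metric.tendsto_nhds]
  intro δ hδ
  filter_upwards [eventually_speed_lt hH hB hvp hδ, self_mem_nhdsWithin] with ε h hε
  obtain ⟨y, hy⟩ := exists_criticalSolution hε hH hB
  have h1 := h _ y hy
  have h2 := hy.lt_speed hε hH hB hvp
  rw [Real.dist_eq, abs_lt]
  constructor <;> linarith

/-! ### Limit of the slope profile -/

/-- Otherwise `y` would be increasing at `v`; since `f` decreases beyond `m`, it could not return to
`0` at `1`. -/
theorem IsFirstOrderSolution.speed_mul_le (hε : 0 < ε) (hH : HypH f) (hB : IsTypeB f α)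
    (hvp : IsTangencyLevel f α m vp) (h : IsFirstOrderSolution f ε c y) {v : ℝ}
    (hv : v ∈ Icc m 1) : c * frontSlope ε (y v) ≤ f v := by
  by_contra! hcon
  have hc := h.speed_pos hε hB
  have hm0 : 0 < m := hB.threshold_mem.1.trans hvp.lt_argmax
  have hv' : v ∈ Icc (0 : ℝ) 1 := ⟨hm0.le.trans hv.1, hv.2⟩
  have hyv : 0 < y v := (h.nonneg v hv').lt_of_ne fun h0 => by
    rw [← h0, frontSlope_zero, mul_zero] at hcon
    linarith [hH.nonneg hB v hv']
  have hcont : ContinuousAt (fun t => c * frontSlope ε t) (y v) :=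
    ((continuousOn_frontSlope hε).continuousAt (Ici_mem_nhds hyv)).const_mul c
  -- A level slightly below `y v` still violates the bound and gives the trapping lemma its strictly
  -- positive start.
  obtain ⟨η, hη3, hη1, hη2⟩ := (((hcont.eventually (lt_mem_nhds hcon)).filter_mono
    nhdsWithin_le_nhds).and (Ioo_mem_nhdsLT hyv)).exists
  have hsub : Icc v 1 ⊆ Icc (0 : ℝ) 1 := Icc_subset_Icc_left hv'.1
  have := le_of_deriv_nonneg_of_nonneg (d := fun s => y s - η) hv.2
    (fun s hs => ((h.hasDerivWithinAt s (hsub hs)).mono hsub).sub_const η)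
    (by linarith) (fun s hs h0 => by
      have h1 := mul_le_mul_of_nonneg_left
        (frontSlope_le_frontSlope hε hη1.le (sub_nonneg.1 h0)) hc.le
      have h2 := hvp.strictAntiOn.antitoneOn hv ⟨hv.1.trans hs.1, hs.2⟩ hs.1
      linarith)
  rw [h.map_one] at this
  linarith

theorem IsFirstOrderSolution.antitoneOn (hε : 0 < ε) (hH : HypH f) (hB : IsTypeB f α)
    (hvp : IsTangencyLevel f α m vp) (h : IsFirstOrderSolution f ε c y) :
    AntitoneOn y (Icc m 1) := by
  have hm0 : 0 < m := hB.threshold_mem.1.trans hvp.lt_argmax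
  have hsub : Icc m 1 ⊆ Icc (0 : ℝ) 1 := Icc_subset_Icc_left hm0.le
  exact antitoneOn_of_hasDerivWithinAt_nonpos (convex_Icc m 1) (h.continuousOn.mono hsub)
    (fun v hv => (h.hasDerivWithinAt v (hsub (interior_subset hv))).mono
      (interior_subset.trans hsub)) fun v hv => by
      linarith [h.speed_mul_le hε hH hB hvp (interior_subset hv)]

/-- Where `y` is small and `v ≥ m`, the scaled slope is close to `f`. -/
theorem IsFirstOrderSolution.sub_le_speed_mul {K δ : ℝ} (hε : 0 < ε) (hH : HypH f)
    (hB : IsTypeB f α) (hvp : IsTangencyLevel f α m vp) (hK : 0 < K)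
    (hKf : ∀ x ∈ Icc (0 : ℝ) 1, ∀ y ∈ Icc (0 : ℝ) 1, |f x - f y| ≤ K * |x - y|)
    (h : IsFirstOrderSolution f ε c y) (hδ : 0 < δ) {v : ℝ} (hv : v ∈ Icc m 1)
    (hyv : y v < δ ^ 2 / (4 * K)) : f v - δ ≤ c * frontSlope ε (y v) := by
  have hc := h.speed_pos hε hB
  have hm0 : 0 < m := hB.threshold_mem.1.trans hvp.lt_argmax
  have hv' : v ∈ Icc (0 : ℝ) 1 := ⟨hm0.le.trans hv.1, hv.2⟩
  have hs0 := mul_nonneg hc.le (frontSlope_nonneg hε (h.nonneg v hv'))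
  by_contra! hcon
  -- Over a length `ρ`, `f` drops by at most `δ / 2`, so `y' ≤ -δ / 2` there. The total loss `δ² /
  -- (4 K)` would make `y` negative.
  set ρ := δ / (2 * K) with hρ
  have hρ0 : 0 < ρ := by positivity
  have hKρ : K * ρ = δ / 2 := by rw [hρ]; field_simp
  have h1v : δ ≤ K * (1 - v) := by
    have := (le_abs_self _).trans (hKf v hv' 1 ⟨zero_le_one, le_rfl⟩)
    rw [hH.map_one, abs_sub_comm, abs_of_nonneg (sub_nonneg.2 hv.2)] at this
    linarith
  have hρv : v + ρ ≤ 1 := by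
    have : K * ρ ≤ K * (1 - v) := by linarith
    linarith [le_of_mul_le_mul_left this hK]
  have hsub : Icc v (v + ρ) ⊆ Icc (0 : ℝ) 1 := Icc_subset_Icc hv'.1 hρv
  have hsubm : Icc v (v + ρ) ⊆ Icc m 1 := Icc_subset_Icc hv.1 hρv
  have hd : ∀ s ∈ Icc v (v + ρ), HasDerivWithinAt (fun s => y s + δ / 2 * s)
      (c * frontSlope ε (y s) - f s + δ / 2 * 1) (Icc v (v + ρ)) s := fun s hs =>
    ((h.hasDerivWithinAt s (hsub hs)).mono hsub).fun_add ((hasDerivWithinAt_id s _).const_mul _)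
  have hanti := antitoneOn_of_hasDerivWithinAt_nonpos (convex_Icc v (v + ρ))
    (fun s hs => (hd s hs).continuousWithinAt)
    (fun s hs => (hd s (interior_subset hs)).mono interior_subset) (fun s hs => by
      have hs := interior_subset hs
      have h1 := h.antitoneOn hε hH hB hvp hv (hsubm hs) hs.1
      have h2 := mul_le_mul_of_nonneg_left
        (frontSlope_le_frontSlope hε (h.nonneg s (hsub hs)) h1) hc.le
      have h3 := (le_abs_self _).trans (hKf v hv' s (hsub hs))
      rw [abs_sub_comm, abs_of_nonneg (sub_nonneg.2 hs.1)] at h3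
      have h4 : K * (s - v) ≤ K * ρ := by
        refine mul_le_mul_of_nonneg_left ?_ hK.le
        linarith [hs.2]
      linarith)
  have hl : v ∈ Icc v (v + ρ) := ⟨le_rfl, by linarith⟩
  have hr : v + ρ ∈ Icc v (v + ρ) := ⟨by linarith, le_rfl⟩
  have := hanti hl hr (by linarith)
  have h5 := h.nonneg _ (hsub hr)
  have h6 : δ / 2 * ρ = δ ^ 2 / (4 * K) := by rw [hρ]; field_simp; ring
  simp only at this
  linarith

/-- Uniform convergence of the slope profile away from `v = 0`. -/
theorem eventually_frontSlope_sub_le (hH : HypH f) (hB : IsTypeB f α) (hF : HypFOn f α 1)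
    (hvp : IsTangencyLevel f α m vp) {a η : ℝ} (ha : a ∈ Ioc 0 α) (hη : 0 < η) :
    ∀ᶠ ε in 𝓝[>] (0 : ℝ), ∀ c y, IsFirstOrderSolution f ε c y → ∀ v ∈ Icc a 1,
      |frontSlope ε (y v) - f (max vp v) / f vp| ≤ η := by
  obtain ⟨K, hK, hKf⟩ := exists_abs_sub_le hB hF
  have hα := hB.threshold_mem
  have hp := hvp.speed_pos
  have hm0 : 0 < m := hα.1.trans hvp.lt_argmax
  have hvp0 : 0 < vp := hm0.trans hvp.argmax_lt
  have hvpI : vp ∈ Icc (0 : ℝ) 1 := ⟨hvp0.le, hvp.lt_one.le⟩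
  set D : ℝ → ℝ := fun v => f vp * v - reactionPrimitive f v with hD
  have hDc : ContinuousOn D (Icc 0 1) :=
    (by fun_prop : Continuous fun v => f vp * v).continuousOn.sub
    fun v hv => (hasDerivWithinAt_reactionPrimitive hH.continuousOn v hv).continuousWithinAt
  have hDvp : D vp = 0 := by simp only [hD, hvp.eq_mul]; ring
  set δ := η * f vp / 2 with hδdef
  have hδ : 0 < δ := by positivity
  -- Two errors of size `κ`, from `D` near `vp` and from the speed, must fit below the smallness
  -- threshold `δ² / (4 K)`. In the final estimate `δ + κ ≤ 2 δ = η * f vp`.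
  set κ := min (δ ^ 2 / (8 * K)) δ with hκdef
  have hκ : 0 < κ := lt_min (by positivity) hδ
  have hκ2 : κ + κ ≤ δ ^ 2 / (4 * K) := by
    have : κ ≤ δ ^ 2 / (8 * K) := min_le_left _ _
    have e : δ ^ 2 / (4 * K) = δ ^ 2 / (8 * K) + δ ^ 2 / (8 * K) := by field_simp; norm_num
    linarith
  obtain ⟨b, hb, hbD⟩ : ∃ b ∈ Ico m vp, ∀ v ∈ Icc b vp, D v < κ := by
    have h1 : ∀ᶠ v in 𝓝 vp, D v < κ :=
      (hDc.continuousAt (Icc_mem_nhds hvp0 hvp.lt_one)).eventually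
        (gt_mem_nhds (by rw [hDvp]; exact hκ))
    obtain ⟨l, hl, hlD⟩ := exists_Ioc_subset_of_mem_nhds h1 ⟨m, hvp.argmax_lt⟩
    refine ⟨max m ((l + vp) / 2), ⟨le_max_left _ _, max_lt hvp.argmax_lt ?_⟩, fun v hv => ?_⟩
    · linarith
    · refine hlD ⟨?_, hv.2⟩
      have := (le_max_right _ _).trans hv.1
      linarith
  have hab : a ≤ b := ha.2.trans (hvp.lt_argmax.le.trans hb.1)
  have hb1 : b ≤ 1 := hb.2.le.trans hvp.lt_one.le
  have hsub : Icc a b ⊆ Icc (0 : ℝ) 1 := Icc_subset_Icc ha.1.le hb1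
  obtain ⟨μ, hμ, hμD⟩ : ∃ μ, 0 < μ ∧ ∀ v ∈ Icc a b, 2 * μ ≤ D v := by
    obtain ⟨t, ht, htmin⟩ := isCompact_Icc.exists_isMinOn (nonempty_Icc.2 hab) (hDc.mono hsub)
    have : 0 < D t := sub_pos.2 (hvp.lt_mul t ⟨ha.1.trans_le ht.1, ht.2.trans_lt hb.2⟩)
    refine ⟨D t / 2, by linarith, fun v hv => ?_⟩
    have h1 : D t ≤ D v := htmin hv
    linarith
  -- Lowering the barrier slope by `μ` costs at most `μ` of the margin `2 μ`, and gains at `a` the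
  -- room `μ a > ε` needed to start below `y`.
  have hμq : ∀ v ∈ Icc a b, μ ≤ (f vp - μ) * v - reactionPrimitive f v := by
    intro v hv
    have h1 : 2 * μ ≤ f vp * v - reactionPrimitive f v := hμD v hv
    have h2 := mul_le_mul_of_nonneg_left (hsub hv).2 hμ.le
    linarith
  have hlim := tendsto_frontSlope hμ
  filter_upwards [hlim.eventually (lt_mem_nhds (show 1 - η < 1 by linarith)),
    (hlim.const_mul (f vp)).eventually (lt_mem_nhds (show f vp - μ < f vp * 1 by linarith)),
    self_mem_nhdsWithin, nhdsWithin_le_nhds (Iio_mem_nhds (mul_pos hμ ha.1)),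
    eventually_speed_lt hH hB hvp hκ] with ε h1 h2 hε hεμ h3 c y h v hv
  rw [mem_Ioi] at hε
  rw [mem_Iio] at hεμ
  have hc := h.lt_speed hε hH hB hvp
  have hcκ := h3 c y h
  have hvI : v ∈ Icc (0 : ℝ) 1 := ⟨ha.1.le.trans hv.1, hv.2⟩
  have hg0 := frontSlope_nonneg hε (h.nonneg v hvI)
  have hg1 := frontSlope_lt_one hε (h.nonneg v hvI)
  rcases le_or_gt v b with hvb | hvb
  · rw [max_eq_left (hvb.trans hb.2.le), div_self hp.ne']
    have hvab : v ∈ Icc a b := ⟨hv.1, hvb⟩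
    have haα : a ∈ Icc 0 α := ⟨ha.1.le, ha.2⟩
    have h4 := h.mul_sub_le hε hH hB ha.1.le hb1 (q := f vp - μ)
      (by
        have h5 := h.mul_sub_le_apply hε hB haα
        have h6 := mul_lt_mul_of_pos_right hc ha.1
        rw [reactionPrimitive_eq_zero hH hB haα]
        linarith) hμ.le hμq
      (h2.le.trans (mul_le_mul_of_nonneg_right hc.le (frontSlope_nonneg hε hμ.le))) hvab
    have h5 := frontSlope_le_frontSlope hε hμ.le ((hμq v hvab).trans h4)
    rw [abs_le]
    constructor <;> linarith
  · have hvm : v ∈ Icc m 1 := ⟨hb.1.trans hvb.le, hv.2⟩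
    have hysmall : y v < δ ^ 2 / (4 * K) := by
      refine lt_of_lt_of_le ?_ hκ2
      rcases le_or_gt v vp with hvv | hvv
      · have h4 := h.le_mul_sub hε hH hB hvI
        have h5 : f vp * v - reactionPrimitive f v < κ := hbD v ⟨hvb.le, hvv⟩
        have h6 := mul_le_mul_of_nonneg_left hv.2 (sub_nonneg.2 hc.le)
        linarith
      · have h4 := h.le_mul_sub hε hH hB hvpI
        have h5 := h.antitoneOn hε hH hB hvp ⟨hvp.argmax_lt.le, hvp.lt_one.le⟩ hvm hvv.le
        have h6 := mul_le_mul_of_nonneg_left hvp.lt_one.le (sub_nonneg.2 hc.le)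
        rw [hvp.eq_mul] at h4
        linarith
    have h4 := h.sub_le_speed_mul hε hH hB hvp hK hKf hδ hvm hysmall
    have h5 := h.speed_mul_le hε hH hB hvp hvm
    have hκδ : κ ≤ δ := min_le_right _ _
    have h6 : f (max vp v) ≤ f v := by
      refine hvp.strictAntiOn.antitoneOn hvm ⟨hvm.1.trans (le_max_right _ _), ?_⟩ (le_max_right _ _)
      exact max_le hvp.lt_one.le hv.2
    have h7 : c * frontSlope ε (y v) ≤ f (max vp v) + κ := by
      rcases le_total v vp with hvv | hvv
      · rw [max_eq_left hvv]
        have := mul_le_mul_of_nonneg_left hg1.le (hp.trans hc).le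
        linarith
      · rw [max_eq_right hvv]
        linarith
    have h8 : (c - f vp) * frontSlope ε (y v) ≤ κ := by
      have := mul_le_mul_of_nonneg_left hg1.le (sub_nonneg.2 hc.le)
      linarith
    have h9 : 0 ≤ (c - f vp) * frontSlope ε (y v) := mul_nonneg (sub_nonneg.2 hc.le) hg0
    have e : frontSlope ε (y v) - f (max vp v) / f vp =
        (f vp * frontSlope ε (y v) - f (max vp v)) / f vp := by field_simp
    rw [e, abs_div, abs_of_pos hp, div_le_iff₀ hp, abs_le]
    constructor <;> linarith
end

/-! ### The inviscid profile and uniform convergence of fronts -/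

section
variable {f V : ℝ → ℝ} {α ε c m vp z₀ : ℝ}

/-- The Lipschitz bound together with `f α = f 1 = 0` supplies the linear control needed on `(α,
1)`. Monotonicity and the limit at `+∞` serve the tail estimate. -/
theorem exists_isInviscidProfile (hH : HypH f) (hB : IsTypeB f α) (hF : HypFOn f α 1)
    (hvp : IsTangencyLevel f α m vp) (z₀ : ℝ) :
    ∃ V, IsInviscidProfile f (f vp) z₀ vp V ∧ Monotone V ∧ Tendsto V atTop (𝓝 1) := by
  obtain ⟨K, hK, hKf⟩ := exists_abs_sub_le hB hF
  have hα := hB.threshold_mem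
  have hp := hvp.speed_pos
  have hsub : Ioo α 1 ⊆ Icc (0 : ℝ) 1 := fun v hv => ⟨hα.1.le.trans hv.1.le, hv.2.le⟩
  have hpos : ∀ v ∈ Ioo α 1, 0 < f v / f vp := fun v hv => div_pos (hB.pos v hv) hp
  obtain ⟨V, hV, hVd, hV0, -, hVtop⟩ := exists_connection (G := fun v => f v / f vp)
    (a := α) (b := 1) (C := K / f vp) (v₀ := vp) z₀ (by positivity)
    ((hH.continuousOn.mono hsub).div_const _) hpos
    (fun v hv => by
      have := (le_abs_self _).trans (hKf v (hsub hv) α ⟨hα.1.le, hα.2.le⟩)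
      rw [hB.eq_zero α ⟨hα.1.le, le_rfl⟩, sub_zero, abs_of_nonneg (sub_nonneg.2 hv.1.le)] at this
      rw [div_mul_eq_mul_div]
      gcongr)
    (fun v hv => by
      have := (le_abs_self _).trans (hKf v (hsub hv) 1 ⟨zero_le_one, le_rfl⟩)
      rw [hH.map_one, sub_zero, abs_sub_comm, abs_of_nonneg (sub_nonneg.2 hv.2.le)] at this
      rw [div_mul_eq_mul_div]
      gcongr)
    ⟨hvp.lt_argmax.trans hvp.argmax_lt, hvp.lt_one⟩
  refine ⟨V, ⟨fun z => hsub (hV z), fun z => (hVd z).differentiableAt, fun z => ?_, hV0⟩, ?_,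
    hVtop⟩
  · rw [(hVd z).deriv, mul_div_cancel₀ _ hp.ne']
  · refine monotone_of_deriv_nonneg (fun z => (hVd z).differentiableAt) fun z => ?_
    rw [(hVd z).deriv]
    exact (hpos _ (hV z)).le

theorem IsInviscidProfile.hasDerivAt {v₀ : ℝ} (hc : 0 < c) (h : IsInviscidProfile f c z₀ v₀ V)
    (z : ℝ) : HasDerivAt V (f (V z) / c) z := by
  have := (h.differentiable z).hasDerivAt
  rwa [eq_div_of_mul_eq hc.ne' ((mul_comm _ _).trans (h.ode z))] at this

theorem lipschitz_clamp_div (hB : IsTypeB f α) (hF : HypFOn f α 1) {l : ℝ}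
    (hl : l ∈ Icc (0 : ℝ) 1) (c : ℝ) :
    ∃ L, LipschitzWith L fun x => f (max l (min x 1)) / c := by
  obtain ⟨K, hK, hKf⟩ := exists_abs_sub_le hB hF
  have := (lipschitzWith_smul (c⁻¹ : ℝ)).comp (lipschitz_clamp hK.le hKf hl)
  simp only [div_eq_inv_mul]
  exact ⟨_, this⟩

theorem IsInviscidProfile.unique {v₀ : ℝ} {W : ℝ → ℝ} (hB : IsTypeB f α) (hF : HypFOn f α 1)
    (hc : 0 < c) (hV : IsInviscidProfile f c z₀ v₀ V) (hW : IsInviscidProfile f c z₀ v₀ W) :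
    W = V := by
  obtain ⟨L, hL⟩ := lipschitz_clamp_div hB hF ⟨le_rfl, zero_le_one⟩ c
  have key : ∀ U, IsInviscidProfile f c z₀ v₀ U → ∀ z,
      HasDerivAt U (f (max 0 (min (U z) 1)) / c) z := fun U hU z => by
    rw [min_eq_left (hU.mem_Icc z).2, max_eq_right (hU.mem_Icc z).1]
    exact hU.hasDerivAt hc z
  exact ODE_solution_unique_univ (v := fun _ x => f (max 0 (min x 1)) / c) (s := fun _ => univ)
    (K := L) (t₀ := z₀) (fun _ => hL.lipschitzOnWith) (fun t => ⟨key W hW t, trivial⟩)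
    (fun t => ⟨key V hV t, trivial⟩) (by rw [hV.initial, hW.initial])

theorem gluedProfile_of_neg_le (hvp : vp < 1) {z : ℝ} (hz : -α ≤ z) :
    gluedProfile (vp - α) (piecewiseLinearProfile 0 α) V z =
      if z ≤ vp - α then z + α else V z := by
  unfold gluedProfile piecewiseLinearProfile
  split_ifs <;> linarith

/-- Grönwall comparison of an approximate solution with the glued profile on `[0, Z]`. -/
theorem abs_sub_gluedProfile_le {L : NNReal} {v v' : ℝ → ℝ} {δ Z : ℝ} (hα : 0 < α)
    (hvp : IsTangencyLevel f α m vp)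
    (hL : LipschitzWith L fun x => f (max vp (min x 1)) / f vp)
    (hV : IsInviscidProfile f (f vp) (vp - α) vp V) (hVm : Monotone V)
    (hv : ∀ z, HasDerivAt v (v' z) z) (hv0 : v 0 = α)
    (hδ : ∀ z, 0 ≤ z → |v' z - f (max vp (min (v z) 1)) / f vp| ≤ δ) :
    ∀ z ∈ Icc 0 Z, |v z - gluedProfile (vp - α) (piecewiseLinearProfile 0 α) V z| ≤
      gronwallBound 0 L δ z := by
  have hp := hvp.speed_pos
  have hp0 : 0 < vp - α := by linarith [hvp.lt_argmax, hvp.argmax_lt]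
  set g : ℝ → ℝ := fun z => if z ≤ vp - α then z + α else V z with hg
  have hgc : Continuous g := by
    refine Continuous.if_le (by fun_prop) hV.differentiable.continuous continuous_id
      continuous_const fun z hz => ?_
    rw [show z = vp - α from hz, hV.initial]
    ring
  -- Below `vp` the clamped field equals `f vp / f vp = 1`, so the linear and inviscid pieces solve
  -- a single equation; right derivatives suffice at the junction.
  have hgd : ∀ z ∈ Ico 0 Z,
      HasDerivWithinAt g (f (max vp (min (g z) 1)) / f vp) (Ici z) z := by
    intro z hz
    rcases lt_or_ge z (vp - α) with h | h
    · have e : g =ᶠ[𝓝 z] fun z => z + α := by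
        filter_upwards [Iio_mem_nhds h] with s hs
        simp only [hg, if_pos (mem_Iio.1 hs).le]
      have hgz : g z ≤ vp := by rw [e.eq_of_nhds]; linarith
      rw [max_eq_left ((min_le_left _ _).trans hgz), div_self hp.ne']
      exact (((hasDerivAt_id z).add_const α).congr_of_eventuallyEq e).hasDerivWithinAt
    · have e : ∀ s ∈ Ici z, g s = V s := by
        intro s hs
        simp only [hg]
        split_ifs with h'
        · have : s = vp - α := le_antisymm h' (h.trans hs)
          rw [this, hV.initial]
          ring
        · rfl
      have hz' := e z self_mem_Ici
      have hVz : vp ≤ V z := hV.initial ▸ hVm h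
      rw [hz', min_eq_left (hV.mem_Icc z).2, max_eq_right hVz]
      exact (hV.hasDerivAt hp z).hasDerivWithinAt.congr e hz'
  have := dist_le_of_approx_trajectories_ODE (v := fun _ x => f (max vp (min x 1)) / f vp)
    (f := v) (g := g) (f' := v') (g' := fun z => f (max vp (min (g z) 1)) / f vp) (K := L)
    (εf := δ) (εg := 0) (δ := 0) (a := 0) (b := Z) (fun _ => hL)
    (fun z _ => (hv z).continuousAt.continuousWithinAt) (fun z _ => (hv z).hasDerivWithinAt)
    (fun z hz => hδ z hz.1) hgc.continuousOn hgd (fun z _ => (dist_self _).le)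
    (by simp [hg, hv0, hp0.le])
  intro z hz
  have h1 := this z hz
  rw [sub_zero, add_zero, Real.dist_eq] at h1
  rwa [gluedProfile_of_neg_le hvp.lt_one (by linarith [hz.1])]

theorem tendstoUniformly_criticalFront (hH : HypH f) (hB : IsTypeB f α) (hF : HypFOn f α 1)
    (hvp : IsTangencyLevel f α m vp) (hV : IsInviscidProfile f (f vp) (vp - α) vp V)
    (hVm : Monotone V) (hVtop : Tendsto V atTop (𝓝 1)) {v : ℝ → ℝ → ℝ}
    (hv : ∀ ε : ℝ, 0 < ε → IsCriticalFront f α ε (v ε)) :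
    TendstoUniformly v (gluedProfile (vp - α) (piecewiseLinearProfile 0 α) V) (𝓝[>] 0) := by
  have hα := hB.threshold_mem
  have hp := hvp.speed_pos
  have hαvp := hvp.lt_argmax.trans hvp.argmax_lt
  have hvp0 : 0 < vp := hα.1.trans hαvp
  obtain ⟨L, hL⟩ := lipschitz_clamp_div hB hF ⟨hvp0.le, hvp.lt_one.le⟩ (f vp)
  set g := gluedProfile (vp - α) (piecewiseLinearProfile 0 α) V with hg
  rw [Metric.tendstoUniformly_iff]
  intro η hη
  -- Beyond `Z` the front and the profile are monotone and bounded by `1`, so closeness at `Z`,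
  -- where `V` is nearly `1`, controls the whole tail.
  obtain ⟨Z, hZ1, hZ2⟩ := ((hVtop.eventually (lt_mem_nhds (show 1 - η / 4 < 1 by linarith))).and
    (eventually_gt_atTop (vp - α))).exists
  have hZ0 : 0 ≤ Z := by linarith
  set a := min α (η / 4) with ha
  have ha0 : 0 < a := lt_min hα.1 (by linarith)
  have haα : a ≤ α := min_le_left _ _
  have haη : a ≤ η / 4 := min_le_right _ _
  obtain ⟨δ, hδη, hδ0, hδ1⟩ : ∃ δ, gronwallBound 0 L δ Z < η / 4 ∧ 0 < δ ∧ δ < η / 4 := by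
    have h1 : ∀ᶠ δ in 𝓝[>] (0 : ℝ), gronwallBound 0 L δ Z < η / 4 := by
      refine ((gronwallBound_continuous_ε 0 L Z).continuousAt.eventually
        (gt_mem_nhds ?_)).filter_mono nhdsWithin_le_nhds
      simp only [gronwallBound_ε0_δ0]
      linarith
    exact (h1.and (Ioo_mem_nhdsGT (by linarith))).exists
  filter_upwards [eventually_frontSlope_sub_le hH hB hF hvp ⟨ha0, haα⟩ hδ0, self_mem_nhdsWithin]
    with ε hε hε0 z
  obtain ⟨y, hy, hvI, hvd⟩ := (hv ε hε0).exists_hasDerivAt hε0 hH hB hF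
  have hv0 := (hv ε hε0).2
  have hmono := (hv ε hε0).1.monotone
  have hslope := hε _ y hy
  have hpos : ∀ z, 0 ≤ z → |v ε z - g z| ≤ η / 2 := by
    have hgron : ∀ z ∈ Icc 0 Z, |v ε z - g z| ≤ η / 4 := by
      intro z hz
      refine (abs_sub_gluedProfile_le (δ := δ) hα.1 hvp hL hV hVm hvd hv0
        (fun z hz0 => ?_) z hz).trans ?_
      · rw [min_eq_left (hvI z).2.le]
        refine hslope _ ⟨haα.trans ?_, (hvI z).2.le⟩
        rw [← hv0]
        exact hmono hz0
      · exact (gronwallBound_mono le_rfl hδ0.le L.2 hz.2).trans hδη.le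
    intro z hz
    rcases le_total z Z with h | h
    · linarith [hgron z ⟨hz, h⟩]
    · have hgV : ∀ z, Z ≤ z → g z = V z := fun z hz => if_neg (by linarith)
      have h1 := (abs_le.1 (hgron Z ⟨hZ0, le_rfl⟩)).1
      rw [hgV Z le_rfl] at h1
      have h2 := hmono h
      have h3 := hVm h
      have h4 := (hV.mem_Icc z).2
      have h5 := (hvI z).2
      rw [hgV z h, abs_le]
      constructor <;> linarith
  -- The slope is below `1`, so going left from `v(0) = α` the front stays above the line and hence
  -- above level `a`. There the slope estimate applies and gives the upper bound.
  have hlin : ∀ z ∈ Icc (a - α) 0, z + α ≤ v ε z ∧ v ε z ≤ z + α + η / 4 := by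
    have hd1 : ∀ z, HasDerivAt (fun z => z - v ε z) (1 - frontSlope ε (y (v ε z))) z := fun z =>
      (hasDerivAt_id z).fun_sub (hvd z)
    have hm1 : Monotone fun z => z - v ε z := by
      refine monotone_of_deriv_nonneg (fun z => (hd1 z).differentiableAt) fun z => ?_
      rw [(hd1 z).deriv]
      linarith [frontSlope_lt_one hε0 (hy.pos _ (hvI z)).le]
    have hlow : ∀ z ≤ 0, z + α ≤ v ε z := fun z hz => by
      have := hm1 hz
      simp only [hv0] at this
      linarith
    have hd2 : ∀ z, HasDerivAt (fun z => v ε z - (1 - δ) * z)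
        (frontSlope ε (y (v ε z)) - (1 - δ) * 1) z := fun z =>
      (hvd z).fun_sub ((hasDerivAt_id z).const_mul _)
    have hm2 := monotoneOn_of_hasDerivWithinAt_nonneg (convex_Icc (a - α) 0)
      (fun z _ => (hd2 z).continuousAt.continuousWithinAt) (fun z _ => (hd2 z).hasDerivWithinAt)
      (fun z hz => by
        have hz := interior_subset hz
        have h1 : v ε z ≤ α := hv0 ▸ hmono hz.2
        have h2 := (abs_le.1 (hslope (v ε z)
          ⟨by linarith [hlow z hz.2, hz.1], (hvI z).2.le⟩)).1
        rw [max_eq_left (h1.trans hαvp.le), div_self hp.ne'] at h2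
        linarith)
    intro z hz
    refine ⟨hlow z hz.2, ?_⟩
    have := hm2 hz ⟨by linarith, le_rfl⟩ hz.2
    simp only [hv0] at this
    have h1 : -z ≤ 1 := by linarith [hz.1, hα.2]
    have h2 := mul_le_mul_of_nonneg_left h1 hδ0.le
    linarith
  have key : |v ε z - g z| ≤ η / 2 := by
    rcases le_total 0 z with h | h
    · exact hpos z h
    rcases le_total (a - α) z with h' | h'
    · obtain ⟨h1, h2⟩ := hlin z ⟨h', h⟩
      rw [hg, gluedProfile_of_neg_le hvp.lt_one (by linarith), if_pos (by linarith), abs_le]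
      constructor <;> linarith
    -- To the left of `a - α` both functions lie between `0` and `a + η / 4 ≤ η / 2`.
    · have h1 := (hlin (a - α) ⟨le_rfl, by linarith⟩).2
      have h2 := hmono h'
      have h3 := (hvI z).1
      have h4 : 0 ≤ g z ∧ g z ≤ a := by
        simp only [hg, gluedProfile, piecewiseLinearProfile]
        split_ifs <;> constructor <;> linarith
      rw [abs_le]
      constructor <;> linarith
  rw [dist_comm, Real.dist_eq]
  linarith
end

theorem mainTheorem2 (f : ℝ → ℝ) (α : ℝ) (hH : HypH f) (hB : IsTypeB f α)
    (hF : HypFOn f α 1) :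
    -- the critical speed and the normalized critical front are well defined
    (∀ ε : ℝ, 0 < ε →
      {c : ℝ | IsAdmissibleSpeed f ε c} = {criticalSpeed f ε} ∧
      ∃! v : ℝ → ℝ, IsCriticalFront f α ε v) ∧
    -- `vp` is the largest solution of `F(v) = v f(v)`
    ∃ vp : ℝ, vp ∈ Ioo α 1 ∧
      IsGreatest {v : ℝ | v ∈ Icc (0 : ℝ) 1 ∧ reactionPrimitive f v = v * f v} vp ∧
      -- convergence of the critical speeds
      Tendsto (fun ε => criticalSpeed f ε) (𝓝[>] 0) (𝓝 (f vp)) ∧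
      -- uniform convergence of the critical fronts to the glued profile
      ∃ V : ℝ → ℝ, IsInviscidProfile f (f vp) (vp - α) vp V ∧
        (∀ W : ℝ → ℝ, IsInviscidProfile f (f vp) (vp - α) vp W → W = V) ∧
        ∀ v : ℝ → ℝ → ℝ, (∀ ε : ℝ, 0 < ε → IsCriticalFront f α ε (v ε)) →
          TendstoUniformly v
            (gluedProfile (vp - α) (piecewiseLinearProfile 0 α) V) (𝓝[>] 0) := by
  refine ⟨fun ε hε => ⟨setOf_isAdmissibleSpeed_eq hε hH hB,
    existsUnique_isCriticalFront hε hH hB hF⟩, ?_⟩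
  obtain ⟨m, vp, hvp⟩ := exists_isTangencyLevel hH hB hF
  obtain ⟨V, hV, hVm, hVtop⟩ := exists_isInviscidProfile hH hB hF hvp (vp - α)
  exact ⟨vp, ⟨hvp.lt_argmax.trans hvp.argmax_lt, hvp.lt_one⟩, hvp.isGreatest,
    tendsto_criticalSpeed hH hB hvp, V, hV, fun W hW => hV.unique hB hF hvp.speed_pos hW,
    fun v hv => tendstoUniformly_criticalFront hH hB hF hvp hV hVm hVtop hv⟩
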